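/- **Setting.** Fix an integer $N\ge 1$ and put $V=\mathbb C^N$. Let $e_{ab}$, $a,b=1,\dots,N$, be the standard generators of $\mathfrak{gl}_N$ (over $\mathbb C$), and $e_{ab}^{\{s\}}=e_{ab}x^s$, $s\ge 0$, the generators of the current algebra $\mathfrak{gl}_N[x]$. Let $\tau$ be the linear antiinvolution ($\tau(XY)=\tau(Y)\tau(X)$) of $U(\mathfrak{gl}_N[x])$ with $\tau(e_{ab}^{\{s\}})=e_{ba}^{\{s\}}$, and also its restriction to $U(\mathfrak{gl}_N)$, $\tau(e_{ab})=e_{ba}$. Put $$L_{ab}(u)=\sum_{s\ge 0}e_{ba}^{\{s\}}u^{-s-1},\qquad L(u)=\sum_{a,b=1}^N E_{ab}\otimes L_{ab}(u).$$ For a complex $N\times N$ matrix $K$, let $\mathcal G_{k,K}(u)\in U(\mathfrak{gl}_N[x])[[u^{-1}]]$ be the coefficients of the formal differential operator $$(\operatorname{tr}_{V^{\otimes N}}\otimes\mathrm{id})\Bigl(\bigl(\partial_u-K^{(1)}-L^{(1)}(u)\bigr)\cdots\bigl(\partial_u-K^{(N)}-L^{(N)}(u)\bigr)\,\mathbb A\Bigr)=\sum_{k=0}^N(-1)^k\,\mathcal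 G_{k,K}(u)\,\partial_u^{N-k},$$ where the superscript $(i)$ means that the matrix part acts in the $i$-th factor of $V^{\otimes N}$, and $\mathbb A$ is the skew-symmetrization projector of $V^{\otimes N}$. Let $M_1,\dots,M_n$ be highest weight $\mathfrak{gl}_N$-modules with highest weight vectors $v_1,\dots,v_n$ (that is, $v_i\neq 0$ is a weight vector, $e_{ab}v_i=0$ for $a<b$, and $v_i$ generates $M_i$), and let $z_1,\dots,z_n\in\mathbb C$. Let $M_i(z_i)$ be the evaluation module, on which $e_{ab}^{\{s\}}$ acts as $z_i^s e_{ab}$. The transfer matrices $\mathcal G_{k,K}^{M_1\otimes\dots\otimes M_n}(u;z)$ of the Gaudin model are the operators by which the series $\mathcal G_{k,K}(u)$ acts in $M_1(z_1)\otimes\dots\otimes M_n(z_n)$. The Shapovalov form $S_{M_i}$ is the symmetric bilinear form on $M_i$ such that $S_{M_i}(v_i,v_i)=1$ and $S_{M_i}(Xw_1,w_2)=S_{M_i}(w_1,\tau(X)w_2)$ for all $X\in U(\mathfrak{gl}_N)$ and $w_1,w_2\in M_i$. **Theorem 9.1.** 1. For every complex $N\times N$ matrix $K$ and every $k=1,\dots,N$,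 one has $\tau(\mathcal G_{k,K}(u))=\mathcal G_{k,K^\dagger}(u)$, where $\dagger$ is the transposition of matrices and $\tau$ is applied to the coefficients of the series. 2. For each $i$, the Shapovalov form $S_{M_i}$ exists and is unique. 3. Let $K$ be symmetric, $K=K^\dagger$. Then for every $k=1,\dots,N$ the operators $\mathcal G_{k,K}^{M_1\otimes\dots\otimes M_n}(u;z)$ are symmetric with respect to the tensor product $S=S_{M_1}\otimes\dots\otimes S_{M_n}$ of the Shapovalov forms: $$S\bigl(\mathcal G_{k,K}^{M_1\otimes\dots\otimes M_n}(u;z)\,w_1,\,w_2\bigr)=S\bigl(w_1,\,\mathcal G_{k,K}^{M_1\otimes\dots\otimes M_n}(u;z)\,w_2\bigr)\qquad\text{for all } w_1,w_2\in M_1\otimes\dots\otimes M_n.$$ This holds as an identity of series in $u^{-1}$. Moreover, $\mathcal G_{k,K}^{M_1\otimes\dots\otimes M_n}(u;z)$ is the expansion at $u=\infty$ of an operator-valued rational function $P(u)\prod_{i=1}^n(u-z_i)^{-k}$, with $P$ a polynomial in $u$ with coefficients in $\operatorname{End}(M_1\otimes\dots\otimes M_n)$, and the identity also holds for the values of this rational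 function at every $u\in\mathbb C\setminus\{z_1,\dots,z_n\}$. -/

import Mathlib

open scoped TensorProduct

attribute [local instance 100] LieRing.ofAssociativeRing

noncomputable section

/-! ### The Lie algebras `gl_N`, `gl_N[x]` and the transposition antiinvolution -/

/-- `N × N` matrices over a commutative `ℂ`-algebra `R`, regarded as a complex Lie algebra with the
commutator bracket. For `R = ℂ` this is `gl_N`, with `e_ab` the matrix unit; for `R = ℂ[x]` this is
`gl_N[x]`, with `e_ab x^s` the matrix whose only nonzero entry is `x^s` in position `(a, b)`. -/
abbrev LieGl (N : ℕ) (R : Type) [CommRing R] : Type := Matrix (Fin N) (Fin N) R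

/-- The universal enveloping algebra `U(gl_N)` (for `R = ℂ`) or `U(gl_N[x])` (for `R = ℂ[x]`). -/
abbrev EnvGl (N : ℕ) (R : Type) [CommRing R] [Algebra ℂ R] : Type :=
  UniversalEnvelopingAlgebra ℂ (LieGl N R)

/-- The Lie algebra map `x ↦ ι(xᵀ)` from `gl_N(R)` to the opposite algebra of `U(gl_N(R))`. -/
def transposeLieHom (N : ℕ) (R : Type) [CommRing R] [Algebra ℂ R] :
    LieGl N R →ₗ⁅ℂ⁆ (EnvGl N R)ᵐᵒᵖ where
  toFun x := MulOpposite.op (UniversalEnvelopingAlgebra.ι ℂ x.transpose)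
  map_add' x y := by simp
  map_smul' c x := by simp
  map_lie' := by
    intro x y
    rw [Ring.lie_def, Ring.lie_def, Matrix.transpose_sub, Matrix.transpose_mul,
      Matrix.transpose_mul, ← Ring.lie_def, LieHom.map_lie, Ring.lie_def]
    rfl

/-- The antiinvolution `τ` of `U(gl_N(R))`: the linear map with `τ(XY) = τ(Y) τ(X)` and
`τ(x) = xᵀ` for `x` in `gl_N(R)`; so `τ(e_ab x^s) = e_ba x^s`. -/
def tau (N : ℕ) (R : Type) [CommRing R] [Algebra ℂ R] (X : EnvGl N R) : EnvGl N R :=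
  MulOpposite.unop (UniversalEnvelopingAlgebra.lift ℂ (transposeLieHom N R) X)

/-! ### Power series in `u⁻¹` and formal differential operators

A series `∑ c_s u^{-s}` is stored as the `PowerSeries` whose `s`-th coefficient is `c_s`. -/

/-- The derivation `d/du` on series in `u⁻¹`: it sends `u^{-s}` to `-s u^{-s-1}`. -/
def derivU {A : Type*} [Ring A] (f : PowerSeries A) : PowerSeries A :=
  PowerSeries.mk fun s => match s with
    | 0 => 0
    | r + 1 => -((r : A) * PowerSeries.coeff r f)

/-- The product `(∂_u - X) · ∑_j c_j ∂_u^j` of formal differential operators, with all coefficients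
written to the left of the powers of `∂_u`. Since `∂_u c = c ∂_u + c'`, the coefficient of `∂_u^j`
in the product is `c_{j-1} + c_j' - X c_j`. The coefficients are square matrices with entries
series in `u⁻¹`, and the derivative is taken entrywise. -/
def firstOrderMul {I : Type*} [Fintype I] {A : Type*} [Ring A]
    (X : Matrix I I (PowerSeries A)) (c : ℕ → Matrix I I (PowerSeries A)) :
    ℕ → Matrix I I (PowerSeries A) := fun j =>
  (match j with
    | 0 => 0
    | r + 1 => c r) + (c j).map derivU - X * c j

/-! ### The Gaudin transfer matrices

`End(V^{⊗N}) ⊗ A`, where `V = ℂ^N`, is identified with matrices over `A` with rows and columns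
indexed by `Fin N → Fin N`: the index `p` stands for the basis vector
`v_{p 0} ⊗ ⋯ ⊗ v_{p (N-1)}`. -/

/-- For `X = ∑ E_ab ⊗ X_ab`, the element `X^{(i)}` acting in the `i`-th factor of `V^{⊗N}`. -/
def inFactor {N : ℕ} {A : Type*} [Zero A] (X : Matrix (Fin N) (Fin N) A) (i : Fin N) :
    Matrix (Fin N → Fin N) (Fin N → Fin N) A := fun p q =>
  if ∀ j, j ≠ i → p j = q j then X (p i) (q i) else 0

/-- The skew-symmetrization projector of `V^{⊗N}`, which sends `v_{q 0} ⊗ ⋯ ⊗ v_{q (N-1)}` to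
`(1 / N!) ∑_σ sign(σ) v_{q (σ 0)} ⊗ ⋯ ⊗ v_{q (σ (N-1))}`, as a matrix over a `ℂ`-algebra. -/
def skewProjector (N : ℕ) (A : Type*) [Ring A] [Algebra ℂ A] :
    Matrix (Fin N → Fin N) (Fin N → Fin N) A := fun p q =>
  algebraMap ℂ A ((N.factorial : ℂ)⁻¹ *
    ∑ σ : Equiv.Perm (Fin N), if p = q ∘ σ then ((Equiv.Perm.sign σ : ℤ) : ℂ) else 0)

/-- The series `L_ab(u) = ∑_{s ≥ 0} e_ba^{(s)} u^{-s-1}`, where `e_ba^{(s)} = e_ba x^s`. -/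
def currentSeries (N : ℕ) (a b : Fin N) : PowerSeries (EnvGl N (Polynomial ℂ)) :=
  PowerSeries.mk fun s => match s with
    | 0 => 0
    | r + 1 => UniversalEnvelopingAlgebra.ι ℂ
        (Matrix.single b a ((Polynomial.X : Polynomial ℂ) ^ r))

/-- The matrix `K + L(u)` of series in `u⁻¹`. -/
def shiftedCurrent {N : ℕ} (K : Matrix (Fin N) (Fin N) ℂ) :
    Matrix (Fin N) (Fin N) (PowerSeries (EnvGl N (Polynomial ℂ))) := fun a b =>
  algebraMap ℂ _ (K a b) + currentSeries N a b

/-- The coefficients, at the powers of `∂_u`, of the operator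
`(∂_u - K^{(1)} - L^{(1)}(u)) ⋯ (∂_u - K^{(N)} - L^{(N)}(u))`. -/
def gaudinProduct {N : ℕ} (K : Matrix (Fin N) (Fin N) ℂ) :
    ℕ → Matrix (Fin N → Fin N) (Fin N → Fin N) (PowerSeries (EnvGl N (Polynomial ℂ))) :=
  (List.finRange N).foldr (fun i c => firstOrderMul (inFactor (shiftedCurrent K) i) c)
    (fun j => if j = 0 then 1 else 0)

/-- The coefficient at `∂_u^j` of the differential operator `D_K(u, ∂_u)`, the trace over `V^{⊗N}`
of the above product multiplied on the right by the skew-symmetrization projector. -/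
def gaudinOperator {N : ℕ} (K : Matrix (Fin N) (Fin N) ℂ) (j : ℕ) :
    PowerSeries (EnvGl N (Polynomial ℂ)) :=
  (gaudinProduct K j * skewProjector N _).trace

/-- The Gaudin transfer matrix `G_{k,K}(u)`, a series in `u⁻¹` over `U(gl_N[x])`, defined for
`k ≤ N` by `D_K(u, ∂_u) = ∑_{k=0}^N (-1)^k G_{k,K}(u) ∂_u^{N-k}`. -/
def gaudinTransfer {N : ℕ} (K : Matrix (Fin N) (Fin N) ℂ) (k : ℕ) :
    PowerSeries (EnvGl N (Polynomial ℂ)) :=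
  (-1) ^ k * gaudinOperator K (N - k)

/-! ### Tensor products of evaluation modules -/

section TensorProducts

variable {n : ℕ} {M : Fin n → Type*} [∀ i, AddCommGroup (M i)] [∀ i, Module ℂ (M i)]

/-- The operator `1 ⊗ ⋯ ⊗ f ⊗ ⋯ ⊗ 1` on `M_1 ⊗ ⋯ ⊗ M_n` with `f` acting in the `i`-th factor,
as a linear function of `f`. -/
def atSite (i : Fin n) :
    Module.End ℂ (M i) →ₗ[ℂ] Module.End ℂ (⨂[ℂ] j, M j) :=
  (PiTensorProduct.mapMultilinear ℂ M M).toLinearMap (fun _ => LinearMap.id) i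

theorem atSite_apply (i : Fin n) (f : Module.End ℂ (M i)) :
    atSite i f = PiTensorProduct.map (Function.update (fun j => (1 : Module.End ℂ (M j))) i f) :=
  rfl

theorem atSite_mul (i : Fin n) (f g : Module.End ℂ (M i)) :
    atSite i (f * g) = atSite i f * atSite i g := by
  rw [atSite_apply, atSite_apply, atSite_apply, ← PiTensorProduct.map_mul]
  congr 1
  funext j
  rcases eq_or_ne j i with rfl | h
  · simp
  · simp [Function.update_of_ne h]

theorem atSite_comm {i j : Fin n} (h : i ≠ j) (f : Module.End ℂ (M i)) (g : Module.End ℂ (M j)) :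
    atSite i f * atSite j g = atSite j g * atSite i f := by
  rw [atSite_apply, atSite_apply, ← PiTensorProduct.map_mul, ← PiTensorProduct.map_mul]
  congr 1
  funext l
  rcases eq_or_ne l i with rfl | hi
  · simp [Function.update_of_ne h]
  · rcases eq_or_ne l j with rfl | hj
    · simp [Function.update_of_ne hi]
    · simp [Function.update_of_ne hi, Function.update_of_ne hj]

variable {N : ℕ} [∀ i, LieRingModule (LieGl N ℂ) (M i)] [∀ i, LieModule ℂ (LieGl N ℂ) (M i)]

/-- The action of `gl_N[x]` on the tensor product `M_1(z_1) ⊗ ⋯ ⊗ M_n(z_n)` of evaluation modules: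
on the evaluation module `M(y)` the polynomial matrix `A(x)` acts as `A(y)`, that is,
`e_ab x^s` acts as `y^s e_ab`, and on the tensor product it acts by the coproduct rule. -/
def evalTensorAction (M : Fin n → Type*) [∀ i, AddCommGroup (M i)] [∀ i, Module ℂ (M i)]
    [∀ i, LieRingModule (LieGl N ℂ) (M i)] [∀ i, LieModule ℂ (LieGl N ℂ) (M i)] (z : Fin n → ℂ) :
    LieGl N (Polynomial ℂ) →ₗ⁅ℂ⁆ Module.End ℂ (⨂[ℂ] j, M j) where
  toFun A := ∑ i, atSite i
    (LieModule.toEnd ℂ (LieGl N ℂ) (M i) (A.map (Polynomial.evalRingHom (z i))))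
  map_add' A B := by
    rw [← Finset.sum_add_distrib]
    refine Finset.sum_congr rfl fun i _ => ?_
    rw [Matrix.map_add _ (map_add _), map_add, map_add]
  map_smul' c A := by
    rw [Finset.smul_sum]
    refine Finset.sum_congr rfl fun i _ => ?_
    have h : (c • A).map (Polynomial.evalRingHom (z i))
        = c • A.map (Polynomial.evalRingHom (z i)) := by
      ext a b
      simp
    rw [h, map_smul, map_smul, RingHom.id_apply]
  map_lie' := by
    intro A B
    have key : ∀ i, (⁅A, B⁆ : LieGl N (Polynomial ℂ)).map (Polynomial.evalRingHom (z i))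
        = ⁅(A.map (Polynomial.evalRingHom (z i)) : LieGl N ℂ),
            (B.map (Polynomial.evalRingHom (z i)) : LieGl N ℂ)⁆ := by
      intro i
      rw [Ring.lie_def, Ring.lie_def, Matrix.map_sub _ (map_sub _), Matrix.map_mul, Matrix.map_mul]
    simp only [key, LieHom.map_lie]
    simp only [Ring.lie_def, map_sub, atSite_mul]
    rw [Finset.sum_mul_sum, Finset.sum_mul_sum]
    conv_rhs => rw [Finset.sum_comm (γ := Fin n), ← Finset.sum_sub_distrib]
    refine Finset.sum_congr rfl fun i _ => ?_
    rw [← Finset.sum_sub_distrib, eq_comm]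
    refine Finset.sum_eq_single i ?_ ?_
    · intro j _ hj
      rw [atSite_comm hj, sub_self]
    · simp

/-- The transfer matrix of the Gaudin model, `G^{M_1 ⊗ ⋯ ⊗ M_n}_{k,K}(u; z)`: the series
`G_{k,K}(u)` acting in `M_1(z_1) ⊗ ⋯ ⊗ M_n(z_n)`, a series in `u⁻¹` whose coefficients are
operators on `M_1 ⊗ ⋯ ⊗ M_n`. -/
def gaudinTransferOn (M : Fin n → Type*) [∀ i, AddCommGroup (M i)] [∀ i, Module ℂ (M i)]
    [∀ i, LieRingModule (LieGl N ℂ) (M i)] [∀ i, LieModule ℂ (LieGl N ℂ) (M i)] (z : Fin n → ℂ)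
    (K : Matrix (Fin N) (Fin N) ℂ) (k : ℕ) : PowerSeries (Module.End ℂ (⨂[ℂ] j, M j)) :=
  PowerSeries.map
    (UniversalEnvelopingAlgebra.lift ℂ (evalTensorAction M z)).toRingHom (gaudinTransfer K k)

/-- The tensor product of bilinear forms: the bilinear form on `M_1 ⊗ ⋯ ⊗ M_n` with value
`∏ i, S_i(x_i, y_i)` at `x_1 ⊗ ⋯ ⊗ x_n` and `y_1 ⊗ ⋯ ⊗ y_n`. -/
def tensorForm (S : ∀ i, LinearMap.BilinForm ℂ (M i)) :
    LinearMap.BilinForm ℂ (⨂[ℂ] j, M j) :=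
  (PiTensorProduct.map₂ S).compr₂
    (PiTensorProduct.lift (MultilinearMap.mkPiAlgebra ℂ (Fin n) ℂ))

theorem tensorForm_tprod (S : ∀ i, LinearMap.BilinForm ℂ (M i)) (x y : ∀ i, M i) :
    tensorForm S (PiTensorProduct.tprod ℂ x) (PiTensorProduct.tprod ℂ y)
      = ∏ i, S i (x i) (y i) := by
  simp [tensorForm, PiTensorProduct.map₂_tprod_tprod]

end TensorProducts

/-! ### Highest weight modules and the Shapovalov form -/

section HighestWeight

variable {N : ℕ} {M : Type*} [AddCommGroup M] [Module ℂ M] [LieRingModule (LieGl N ℂ) M]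
  [LieModule ℂ (LieGl N ℂ) M]

/-- `M` is a highest weight `gl_N`-module with highest weight vector `v` of weight `Λ`: the vector
`v` is a nonzero singular vector of weight `Λ` and it generates `M`. -/
structure IsHighestWeight (Λ : Fin N → ℂ) (v : M) : Prop where
  ne_zero : v ≠ 0
  weight : ∀ a : Fin N, ⁅(Matrix.single a a 1 : LieGl N ℂ), v⁆ = Λ a • v
  singular : ∀ a b : Fin N, a < b → ⁅(Matrix.single a b 1 : LieGl N ℂ), v⁆ = 0
  generates : LieSubmodule.lieSpan ℂ (LieGl N ℂ) {v} = ⊤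

/-- The properties that characterize the Shapovalov form of a highest weight `gl_N`-module with
highest weight vector `v`: it is a symmetric bilinear form, normalized at `v`, with
`S(X w₁, w₂) = S(w₁, τ(X) w₂)` for all `X` in `U(gl_N)`. -/
structure IsShapovalovForm (v : M) (S : LinearMap.BilinForm ℂ M) : Prop where
  symm : ∀ w₁ w₂ : M, S w₁ w₂ = S w₂ w₁
  normalized : S v v = 1
  contravariant : ∀ (X : EnvGl N ℂ) (w₁ w₂ : M),
    S (UniversalEnvelopingAlgebra.lift ℂ (LieModule.toEnd ℂ (LieGl N ℂ) M) X w₁) w₂ =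
      S w₁ (UniversalEnvelopingAlgebra.lift ℂ (LieModule.toEnd ℂ (LieGl N ℂ) M) (tau N ℂ X) w₂)

end HighestWeight

/-! ### Rational functions and their expansions at infinity -/

/-- A polynomial in `u` with coefficients in `A`, written as a Laurent series in `u⁻¹`. -/
def laurentAtInfinity {A : Type*} [Ring A] (P : Polynomial A) : LaurentSeries A :=
  P.sum fun j c => HahnSeries.single (-(j : ℤ)) c

/-- The series `G` in `u⁻¹` is the expansion at `u = ∞` of the rational function `P(u) / q(u)`,
where `q` is a scalar polynomial: `q(u) G(u) = P(u)`. -/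
def IsExpansionOfRational {A : Type*} [Ring A] [Algebra ℂ A] (G : PowerSeries A)
    (P : Polynomial A) (q : Polynomial ℂ) : Prop :=
  laurentAtInfinity (q.map (algebraMap ℂ A)) * HahnSeries.ofPowerSeries ℤ A G
    = laurentAtInfinity P

end

/-! The antiinvolution `tau`, combined with transposition of the matrix factor, reverses products,
fixes `L(u)` and turns `K` into its transpose. Applied to the trace of an ordered product of
matrices in distinct tensor factors, it gives the trace of the reversed product for the transposed
`K`. Inside the trace with the skew-symmetrizer the order is immaterial: the commutator of two
neighbouring letters has the form `P B - B P`, where `P` exchanges two tensor factors; `P` commutes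
with all other letters and acts on the skew-symmetrizer by `-1`, so the two terms cancel
(`trace_swap_commutator_eq_zero`, `trace_factorWord_perm`). The derivatives do no harm, since they
only shift the index of a coefficient and multiply it by an integer: every coefficient of the
operator product is an integral combination of ordered words, with the same integers for `K` and its
transpose (`operatorProduct_coeff_mem_closure`).

The Shapovalov form is built without Verma modules. A diagonal grading element separates the highest
weight vector `v` from all nonempty lower words, which yields a functional `φ` with `φ v = 1` that
kills the images of the lowering operators. The pair `(v, φ)` is a singular weight vector in `M ⊕
M*`, with `M*` twisted by transposition, and the submodule that it generates is the graph of a map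
`M → M*`, which is the form (`IsHighestWeight.exists_shapovalovForm`).

For symmetric `K` the coefficients of the transfer matrices are fixed by `tau`, and the tensor form
is contravariant for the current algebra because evaluation commutes with transposition. As for
rationality, `K + L(u)` acts as a constant plus simple poles, and both a factor and a derivative
raise the pole order by at most one, so the coefficient at `∂_u^{N-k}` has order at most `k`. The
coefficients of the numerator are linear combinations of those of the expansion, hence symmetric too
(`IsExpansionOfRational.coeff_mem`). -/

noncomputable section

/-! ### Trace identities on `V^{⊗N}` -/

section TraceIdentities

variable {N : ℕ} {A : Type*} [Ring A]

/-- The permutation of the basis of `V^{⊗N}` that exchanges the tensor factors `i` and `j`. -/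
def factorSwap (i j : Fin N) : (Fin N → Fin N) ≃ (Fin N → Fin N) :=
  (Equiv.swap i j).arrowCongr (Equiv.refl _)

theorem factorSwap_apply (i j : Fin N) (p : Fin N → Fin N) (k : Fin N) :
    factorSwap i j p k = p (Equiv.swap i j k) := by
  simp [factorSwap, Equiv.arrowCongr]

theorem factorSwap_factorSwap (i j : Fin N) (p : Fin N → Fin N) :
    factorSwap i j (factorSwap i j p) = p := by
  funext k
  simp [factorSwap_apply]

/-- The exchange of two factors leaves the `l`-th one alone and only permutes the remaining equality
conditions on the indices. -/
theorem inFactor_submatrix_factorSwap (X : Matrix (Fin N) (Fin N) A) {i j l : Fin N}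
    (hi : l ≠ i) (hj : l ≠ j) :
    (inFactor X l).submatrix (factorSwap i j) (factorSwap i j) = inFactor X l := by
  ext p q
  simp only [Matrix.submatrix_apply, inFactor, factorSwap_apply, Equiv.swap_apply_of_ne_of_ne hi hj]
  congr 1
  refine propext ⟨fun h k hk => ?_, fun h k hk => h _ ?_⟩
  · have := h (Equiv.swap i j k) (fun hh => hk (by
      rw [← Equiv.swap_apply_self i j k, hh, Equiv.swap_apply_of_ne_of_ne hi hj]))
    simpa using this
  · intro hh
    exact hk (by rw [← Equiv.swap_apply_self i j k, hh, Equiv.swap_apply_of_ne_of_ne hi hj])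

theorem inFactor_mul_inFactor_apply (X Y : Matrix (Fin N) (Fin N) A) {i j : Fin N} (hij : i ≠ j)
    (p q : Fin N → Fin N) :
    (inFactor X i * inFactor Y j) p q
      = if ∀ k, k ≠ i → k ≠ j → p k = q k then X (p i) (q i) * Y (p j) (q j) else 0 := by
  -- The first factor can change only the `i`-th index and the second only the `j`-th, so the
  -- intermediate index is forced.
  rw [Matrix.mul_apply, Finset.sum_eq_single (Function.update p i (q i))]
  · have h1 : ∀ k, k ≠ i → p k = Function.update p i (q i) k := fun k hk => by
      rw [Function.update_of_ne hk]
    simp only [inFactor, if_pos h1, Function.update_self, Function.update_of_ne hij.symm]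
    have : (∀ k, k ≠ j → Function.update p i (q i) k = q k) ↔
        ∀ k, k ≠ i → k ≠ j → p k = q k := by
      refine ⟨fun h k hi hj => ?_, fun h k hj => ?_⟩
      · have := h k hj
        rwa [Function.update_of_ne hi] at this
      · rcases eq_or_ne k i with rfl | hi
        · simp
        · rw [Function.update_of_ne hi]
          exact h k hi hj
    simp only [this, mul_ite, mul_zero]
  · intro r _ hr
    by_cases h1 : ∀ k, k ≠ i → p k = r k
    · by_cases h2 : ∀ k, k ≠ j → r k = q k
      · refine absurd ?_ hr
        funext k
        rcases eq_or_ne k i with rfl | hi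
        · rw [Function.update_self, h2 k hij]
        · rw [Function.update_of_ne hi, h1 k hi]
      · simp [inFactor, h2]
    · simp [inFactor, h1]
  · simp

/-- The commutation relation `[X^{(i)}, Y^{(j)}] = P_{ij} B^{(i)} - B^{(i)} P_{ij}`, where `P_{ij}`
exchanges two tensor factors, from the relation between the entries. -/
theorem inFactor_commutator {X Y B : Matrix (Fin N) (Fin N) A}
    (h : ∀ a b c d, X a b * Y c d - Y c d * X a b
      = (if a = d then B c b else 0) - (if c = b then B a d else 0))
    {i j : Fin N} (hij : i ≠ j) :
    inFactor X i * inFactor Y j - inFactor Y j * inFactor X i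
      = (inFactor B i).submatrix (factorSwap i j) id
        - (inFactor B i).submatrix id (factorSwap i j) := by
  ext p q
  simp only [Matrix.sub_apply, inFactor_mul_inFactor_apply _ _ hij,
    inFactor_mul_inFactor_apply _ _ hij.symm, Matrix.submatrix_apply, id, inFactor,
    factorSwap_apply, Equiv.swap_apply_left]
  have e0 : (∀ k, k ≠ j → k ≠ i → p k = q k) ↔ ∀ k, k ≠ i → k ≠ j → p k = q k :=
    ⟨fun h k a b => h k b a, fun h k a b => h k b a⟩
  have e1 : (∀ k, k ≠ i → p (Equiv.swap i j k) = q k) ↔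
      (∀ k, k ≠ i → k ≠ j → p k = q k) ∧ p i = q j := by
    refine ⟨fun h => ⟨fun k hi hj => ?_, ?_⟩, fun h k hi => ?_⟩
    · simpa [Equiv.swap_apply_of_ne_of_ne hi hj] using h k hi
    · simpa using h j hij.symm
    · rcases eq_or_ne k j with rfl | hj
      · simpa using h.2
      · simpa [Equiv.swap_apply_of_ne_of_ne hi hj] using h.1 k hi hj
  have e2 : (∀ k, k ≠ i → p k = q (Equiv.swap i j k)) ↔
      (∀ k, k ≠ i → k ≠ j → p k = q k) ∧ p j = q i := by
    refine ⟨fun h => ⟨fun k hi hj => ?_, ?_⟩, fun h k hi => ?_⟩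
    · simpa [Equiv.swap_apply_of_ne_of_ne hi hj] using h k hi
    · simpa using h j hij.symm
    · rcases eq_or_ne k j with rfl | hj
      · simpa using h.2
      · simpa [Equiv.swap_apply_of_ne_of_ne hi hj] using h.1 k hi hj
  simp only [e0, e1, e2]
  by_cases hc : ∀ k, k ≠ i → k ≠ j → p k = q k
  · rw [if_pos hc, if_pos hc, h]
    congr 1 <;> exact if_congr (and_iff_right hc).symm rfl rfl
  · simp [hc]

/-- The product of the matrices `(Z s)^{(i)}` over the letters `(i, s)` of a word. -/
def factorWord (Z : ℕ → Matrix (Fin N) (Fin N) A) (w : List (Fin N × ℕ)) :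
    Matrix (Fin N → Fin N) (Fin N → Fin N) A :=
  (w.map fun x => inFactor (Z x.2) x.1).prod

theorem factorWord_submatrix_factorSwap (Z : ℕ → Matrix (Fin N) (Fin N) A) {i j : Fin N} :
    ∀ w : List (Fin N × ℕ), (∀ x ∈ w, x.1 ≠ i ∧ x.1 ≠ j) →
      (factorWord Z w).submatrix (factorSwap i j) (factorSwap i j) = factorWord Z w
  | [], _ => by
    simp [factorWord]
  | x :: w, h => by
    have ih := factorWord_submatrix_factorSwap Z w fun y hy => h y (List.mem_cons_of_mem _ hy)
    have hx := h x List.mem_cons_self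
    simp only [factorWord, List.map_cons, List.prod_cons] at ih ⊢
    rw [← Matrix.submatrix_mul_equiv _ _ _ (factorSwap i j), ih,
      inFactor_submatrix_factorSwap _ hx.1 hx.2]

variable [Algebra ℂ A]

/-- Multiplying the summation permutation by the transposition `(i j)` flips every sign. -/
theorem skewProjector_submatrix_id_factorSwap {i j : Fin N} (hij : i ≠ j) :
    (skewProjector N A).submatrix id (factorSwap i j) = - skewProjector N A := by
  ext p q
  simp only [Matrix.submatrix_apply, id, skewProjector, Matrix.neg_apply, ← map_neg, ← mul_neg,
    ← Finset.sum_neg_distrib]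
  congr 2
  refine Fintype.sum_equiv (Equiv.mulLeft (Equiv.swap i j)) _ _ fun σ => ?_
  have : factorSwap i j q ∘ σ = q ∘ (Equiv.swap i j * σ : Equiv.Perm (Fin N)) := by
    funext k
    simp [factorSwap_apply]
  rw [this]
  simp only [Equiv.coe_mulLeft, Equiv.Perm.sign_mul, Equiv.Perm.sign_swap hij]
  split_ifs <;> simp

theorem skewProjector_comm (p q : Fin N → Fin N) :
    skewProjector N A p q = skewProjector N A q p := by
  simp only [skewProjector]
  congr 2
  refine Fintype.sum_equiv (Equiv.inv _) _ _ fun σ => ?_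
  have : p = q ∘ σ ↔ q = p ∘ (σ⁻¹ : Equiv.Perm (Fin N)) := by
    constructor
    · rintro rfl
      funext k
      simp
    · rintro rfl
      funext k
      simp
  simp [this]

theorem skewProjector_submatrix_factorSwap_id {i j : Fin N} (hij : i ≠ j) :
    (skewProjector N A).submatrix (factorSwap i j) id = - skewProjector N A := by
  ext p q
  rw [Matrix.submatrix_apply, skewProjector_comm]
  have := congr_fun (congr_fun (skewProjector_submatrix_id_factorSwap (A := A) hij) q) p
  rw [Matrix.submatrix_apply, Matrix.neg_apply] at this
  rw [Matrix.neg_apply, skewProjector_comm p q]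
  exact this

/-- Cyclicity of the trace fails over a noncommutative ring; here it survives because the entries of
the projector are scalars. -/
theorem trace_mul_skewProjector_comm (C : Matrix (Fin N → Fin N) (Fin N → Fin N) A) :
    (skewProjector N A * C).trace = (C * skewProjector N A).trace := by
  simp only [Matrix.trace, Matrix.diag, Matrix.mul_apply]
  rw [Finset.sum_comm]
  refine Finset.sum_congr rfl fun p _ => Finset.sum_congr rfl fun q _ => ?_
  exact Algebra.commutes _ _

/-- Inside the trace with the skew-symmetrizer, an element of the form `P_{ij} W - W P_{ij}`
contributes zero if the other factors commute with `P_{ij}`. -/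
theorem trace_swap_commutator_eq_zero {i j : Fin N} (hij : i ≠ j)
    {X Z : Matrix (Fin N → Fin N) (Fin N → Fin N) A}
    (hX : X.submatrix (factorSwap i j) (factorSwap i j) = X)
    (hZ : Z.submatrix (factorSwap i j) (factorSwap i j) = Z)
    (W : Matrix (Fin N → Fin N) (Fin N → Fin N) A) :
    (X * (W.submatrix (factorSwap i j) id - W.submatrix id (factorSwap i j)) * Z
      * skewProjector N A).trace = 0 := by
  set e := factorSwap i j
  set S := skewProjector N A
  have hS1 : S.submatrix id e = -S := skewProjector_submatrix_id_factorSwap hij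
  have hS2 : S.submatrix e id = -S := skewProjector_submatrix_factorSwap_id hij
  have h1 : X * W.submatrix e id * Z * S = (X * W * Z * S).submatrix e id := by
    conv_lhs => rw [← hX, Matrix.submatrix_mul_equiv]
    rfl
  have h2 : X * W.submatrix id e * Z * S = -(X * W * Z * S) := by
    have a1 : W.submatrix id e * Z = (W * Z).submatrix id e := by
      conv_lhs => rw [← hZ]
      exact Matrix.submatrix_mul_equiv W Z id e e
    have a2 : (W * Z).submatrix id e * S = -(W * Z * S) := by
      -- Inserting `P² = 1` lets the exchange pass from the left factor to the skew-symmetrizer.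
      have : S = (S.submatrix e id).submatrix e id := by
        rw [Matrix.submatrix_submatrix]
        ext p q
        simp only [Matrix.submatrix_apply, Function.comp, id]
        rw [show e (e p) = p from factorSwap_factorSwap i j p]
      conv_lhs => rw [this]
      rw [Matrix.submatrix_mul_equiv, hS2, Matrix.mul_neg]
      rfl
    rw [Matrix.mul_assoc X, a1, Matrix.mul_assoc, a2, Matrix.mul_neg, Matrix.mul_assoc X,
      Matrix.mul_assoc X, Matrix.mul_assoc W]
  have h3 : ((X * W * Z * S).submatrix e id).trace = -(X * W * Z * S).trace := by
    -- Cyclicity for a permutation matrix is only a relabelling of the diagonal sum.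
    have : ((X * W * Z * S).submatrix e id).trace = ((X * W * Z * S).submatrix id e).trace := by
      simp only [Matrix.trace, Matrix.diag, Matrix.submatrix_apply, id]
      rw [← Equiv.sum_comp e]
      refine Finset.sum_congr rfl fun p _ => ?_
      rw [show e (e p) = p from factorSwap_factorSwap i j p]
    rw [this, ← Matrix.trace_neg]
    congr 1
    have : (X * W * Z * S).submatrix id e = X * W * Z * S.submatrix id e := rfl
    rw [this, hS1, Matrix.mul_neg]
  rw [Matrix.mul_sub, Matrix.sub_mul, Matrix.sub_mul, Matrix.trace_sub, h1, h2, h3,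
    Matrix.trace_neg, sub_self]

/-- If the entries of the matrices `Z s` satisfy the commutation relations of a current algebra,
the trace of a product of these matrices in distinct tensor factors with the skew-symmetrizer does
not depend on the order of the product. -/
theorem trace_factorWord_perm {Z : ℕ → Matrix (Fin N) (Fin N) A}
    (hZ : ∀ s r, ∃ B : Matrix (Fin N) (Fin N) A, ∀ a b c d,
      Z s a b * Z r c d - Z r c d * Z s a b
        = (if a = d then B c b else 0) - (if c = b then B a d else 0))
    {w w' : List (Fin N × ℕ)} (h : w.Perm w') (hw : (w.map Prod.fst).Nodup) :
    (factorWord Z w * skewProjector N A).trace = (factorWord Z w' * skewProjector N A).trace := by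
  -- The trace identity does not pass to subwords, so the untouched prefix is carried through the
  -- induction.
  suffices H : ∀ pre : List (Fin N × ℕ), ((pre ++ w).map Prod.fst).Nodup →
      (factorWord Z (pre ++ w) * skewProjector N A).trace
        = (factorWord Z (pre ++ w') * skewProjector N A).trace from H [] hw
  clear hw
  induction h with
  | nil => intros; rfl
  | cons x _ ih =>
    intro pre hn
    have := ih (pre ++ [x]) (by simpa using hn)
    simpa using this
  | swap x y l =>
    intro pre hn
    have hn' : ((y :: x :: (pre ++ l)).map Prod.fst).Nodup := by
      refine (List.Perm.nodup_iff (List.Perm.map _ ?_)).1 hn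
      exact (List.perm_append_comm_assoc pre [y, x] l).trans (by simp)
    simp only [List.map_cons, List.nodup_cons, List.mem_cons, not_or, List.mem_map, not_exists,
      not_and] at hn'
    obtain ⟨⟨hyx, hy⟩, hx, -⟩ := hn'
    have hother : ∀ z ∈ pre ++ l, z.1 ≠ y.1 ∧ z.1 ≠ x.1 := fun z hz => ⟨hy z hz, hx z hz⟩
    obtain ⟨B, hB⟩ := hZ y.2 x.2
    have key := trace_swap_commutator_eq_zero hyx
      (factorWord_submatrix_factorSwap Z pre fun z hz => hother z (List.mem_append_left _ hz))
      (factorWord_submatrix_factorSwap Z l fun z hz => hother z (List.mem_append_right _ hz))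
      (inFactor B y.1)
    rw [← inFactor_commutator hB hyx, Matrix.mul_sub, Matrix.sub_mul, Matrix.sub_mul,
      Matrix.trace_sub, sub_eq_zero] at key
    simpa [factorWord, Matrix.mul_assoc] using key
  | trans h1 _ ih1 ih2 =>
    intro pre hn
    rw [ih1 pre hn]
    exact ih2 pre ((List.Perm.nodup_iff ((h1.append_left pre).map _)).1 hn)

end TraceIdentities

/-! ### The antiinvolution and the transfer matrices -/

section Antiinvolution

variable {N : ℕ} {R : Type} [CommRing R] [Algebra ℂ R]

theorem tau_add (X Y : EnvGl N R) : tau N R (X + Y) = tau N R X + tau N R Y := by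
  simp [tau]

theorem tau_neg (X : EnvGl N R) : tau N R (-X) = -tau N R X := by
  simp [tau]

theorem tau_zero : tau N R 0 = 0 := by
  simp [tau]

theorem tau_mul (X Y : EnvGl N R) : tau N R (X * Y) = tau N R Y * tau N R X := by
  simp [tau]

theorem tau_sum {ι : Type*} (s : Finset ι) (f : ι → EnvGl N R) :
    tau N R (∑ i ∈ s, f i) = ∑ i ∈ s, tau N R (f i) := by
  simp [tau]

theorem tau_algebraMap (c : ℂ) : tau N R (algebraMap ℂ _ c) = algebraMap ℂ _ c := by
  simp [tau]

theorem tau_ι (x : LieGl N R) :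
    tau N R (UniversalEnvelopingAlgebra.ι ℂ x) = UniversalEnvelopingAlgebra.ι ℂ x.transpose := by
  rw [tau, UniversalEnvelopingAlgebra.lift_ι_apply]
  rfl

/-- The antiinvolution `τ` applied to the entries of the transposed matrix. -/
def tauTranspose {I : Type*} (C : Matrix I I (EnvGl N R)) : Matrix I I (EnvGl N R) :=
  fun p q => tau N R (C q p)

/-- Transposition alone does not reverse products of matrices with noncommuting entries; the
reversal by `tau` on the entries repairs this. -/
theorem tauTranspose_mul {I : Type*} [Fintype I] (C D : Matrix I I (EnvGl N R)) :
    tauTranspose (C * D) = tauTranspose D * tauTranspose C := by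
  ext p q
  simp [tauTranspose, Matrix.mul_apply, tau_sum, tau_mul]

theorem tauTranspose_one {I : Type*} [DecidableEq I] :
    tauTranspose (1 : Matrix I I (EnvGl N R)) = 1 := by
  ext p q
  rcases eq_or_ne p q with rfl | h
  · simpa [tauTranspose] using tau_algebraMap (N := N) (R := R) 1
  · simp [tauTranspose, Matrix.one_apply_ne h, Matrix.one_apply_ne h.symm, tau_zero]

theorem tau_trace {I : Type*} [Fintype I] (C : Matrix I I (EnvGl N R)) :
    tau N R C.trace = (tauTranspose C).trace := by
  simp [Matrix.trace, tau_sum, tauTranspose]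

theorem tauTranspose_inFactor (X : Matrix (Fin N) (Fin N) (EnvGl N R)) (i : Fin N) :
    tauTranspose (inFactor X i) = inFactor (tauTranspose X) i := by
  ext p q
  simp only [tauTranspose, inFactor, eq_comm (a := q _)]
  split_ifs
  · rfl
  · exact tau_zero

theorem tauTranspose_skewProjector :
    tauTranspose (skewProjector N (EnvGl N R)) = skewProjector N (EnvGl N R) := by
  ext p q
  rw [tauTranspose, skewProjector_comm]
  exact tau_algebraMap _

theorem tauTranspose_factorWord (Z : ℕ → Matrix (Fin N) (Fin N) (EnvGl N R)) :
    ∀ w : List (Fin N × ℕ), tauTranspose (factorWord Z w)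
      = factorWord (fun s => tauTranspose (Z s)) w.reverse
  | [] => by simp [factorWord, tauTranspose_one]
  | x :: w => by
    have ih := tauTranspose_factorWord Z w
    simp only [factorWord, List.map_cons, List.prod_cons, List.reverse_cons, List.map_append,
      List.prod_append, List.map_nil, List.prod_nil, mul_one] at ih ⊢
    rw [tauTranspose_mul, ih, tauTranspose_inFactor]

/-- The antiinvolution replaces the matrices `Z s` by `tauTranspose (Z s)` in the trace of an
ordered product with the skew-symmetrizer. -/
theorem tau_trace_factorWord {Z : ℕ → Matrix (Fin N) (Fin N) (EnvGl N R)}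
    (hZ : ∀ s r, ∃ B : Matrix (Fin N) (Fin N) (EnvGl N R), ∀ a b c d,
      tauTranspose (Z s) a b * tauTranspose (Z r) c d
          - tauTranspose (Z r) c d * tauTranspose (Z s) a b
        = (if a = d then B c b else 0) - (if c = b then B a d else 0))
    {w : List (Fin N × ℕ)} (hw : (w.map Prod.fst).Nodup) :
    tau N R (factorWord Z w * skewProjector N _).trace
      = (factorWord (fun s => tauTranspose (Z s)) w * skewProjector N _).trace := by
  -- The image is the reversed word, with the projector in front; reversal is a permutation of the
  -- letters, which the trace does not see.
  rw [tau_trace, tauTranspose_mul, tauTranspose_skewProjector, trace_mul_skewProjector_comm,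
    tauTranspose_factorWord]
  exact (trace_factorWord_perm hZ w.reverse_perm.symm hw).symm

end Antiinvolution

/-! ### Coefficients of operator products as combinations of ordered words -/

section OperatorProducts

variable {N : ℕ} {A : Type*} [Ring A]

/-- The coefficients, at the powers of `∂_u`, of the product of the operators `∂_u - X^{(i)}` over
the list `l`. -/
def operatorProduct (X : Matrix (Fin N) (Fin N) (PowerSeries A)) (l : List (Fin N)) :
    ℕ → Matrix (Fin N → Fin N) (Fin N → Fin N) (PowerSeries A) :=
  l.foldr (fun i c => firstOrderMul (inFactor X i) c) (fun j => if j = 0 then 1 else 0)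

/-- The matrix of `s`-th coefficients of a matrix of series. -/
def coeffMatrix {I : Type*} (s : ℕ) (C : Matrix I I (PowerSeries A)) : Matrix I I A :=
  C.map (PowerSeries.coeff s)

theorem coeffMatrix_mul {I : Type*} [Fintype I] (s : ℕ) (C D : Matrix I I (PowerSeries A)) :
    coeffMatrix s (C * D)
      = ∑ x ∈ Finset.HasAntidiagonal.antidiagonal s, coeffMatrix x.1 C * coeffMatrix x.2 D := by
  ext p q
  simp only [coeffMatrix, Matrix.map_apply, Matrix.mul_apply, map_sum, PowerSeries.coeff_mul,
    Matrix.sum_apply]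
  rw [Finset.sum_comm]

theorem coeffMatrix_inFactor (s : ℕ) (X : Matrix (Fin N) (Fin N) (PowerSeries A)) (i : Fin N) :
    coeffMatrix s (inFactor X i) = inFactor (coeffMatrix s X) i := by
  ext p q
  simp only [coeffMatrix, Matrix.map_apply, inFactor]
  split_ifs <;> simp

theorem coeffMatrix_derivU_succ {I : Type*} (s : ℕ) (C : Matrix I I (PowerSeries A)) :
    coeffMatrix (s + 1) (C.map derivU) = (-(s : ℤ)) • coeffMatrix s C := by
  ext p q
  simp [coeffMatrix, derivU]

theorem coeffMatrix_derivU_zero {I : Type*} (C : Matrix I I (PowerSeries A)) :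
    coeffMatrix 0 (C.map derivU) = 0 := by
  ext p q
  simp [coeffMatrix, derivU]

/-- The coefficients of two products of first order operators are the same integral combination of
ordered products of the coefficient matrices of the factors. -/
theorem operatorProduct_coeff_mem_closure (X Y : Matrix (Fin N) (Fin N) (PowerSeries A)) :
    ∀ (l : List (Fin N)) (j s : ℕ),
      (coeffMatrix s (operatorProduct X l j), coeffMatrix s (operatorProduct Y l j)) ∈
        AddSubgroup.closure {D | ∃ w : List (Fin N × ℕ), (w.map Prod.fst).Sublist l ∧
          D = (factorWord (fun r => coeffMatrix r X) w, factorWord (fun r => coeffMatrix r Y) w)}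
  | [], j, s => by
    have hz : ∀ s, coeffMatrix s (0 : Matrix (Fin N → Fin N) (Fin N → Fin N) (PowerSeries A)) = 0 :=
      fun s => by ext p q; simp [coeffMatrix]
    have ho : ∀ s, coeffMatrix s (1 : Matrix (Fin N → Fin N) (Fin N → Fin N) (PowerSeries A))
        = if s = 0 then 1 else 0 := fun s => by
      ext p q
      rcases eq_or_ne p q with rfl | h
      · simp only [coeffMatrix, Matrix.map_apply, Matrix.one_apply_eq, PowerSeries.coeff_one]
        split_ifs <;> simp
      · simp only [coeffMatrix, Matrix.map_apply, Matrix.one_apply_ne h, map_zero]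
        split_ifs <;> simp [Matrix.one_apply_ne h]
    have h1 : operatorProduct X [] j = operatorProduct Y [] j := rfl
    rw [h1]
    change (coeffMatrix s (if j = 0 then 1 else 0), coeffMatrix s (if j = 0 then 1 else 0)) ∈ _
    -- Only the constant term of the identity operator is nonzero, and it is the empty word.
    by_cases hj : j = 0 ∧ s = 0
    · obtain ⟨rfl, rfl⟩ := hj
      refine AddSubgroup.subset_closure ⟨[], by simp, ?_⟩
      simp [ho, factorWord]
    · have : coeffMatrix s (if j = 0 then 1 else 0 :
          Matrix (Fin N → Fin N) (Fin N → Fin N) (PowerSeries A)) = 0 := by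
        split_ifs with h0
        · rw [ho, if_neg fun h => hj ⟨h0, h⟩]
        · exact hz s
      rw [this]
      exact zero_mem _
  | i :: l, j, s => by
    have ih := operatorProduct_coeff_mem_closure X Y l
    have hle : AddSubgroup.closure {D | ∃ w : List (Fin N × ℕ), (w.map Prod.fst).Sublist l ∧
          D = (factorWord (fun r => coeffMatrix r X) w, factorWord (fun r => coeffMatrix r Y) w)} ≤
        AddSubgroup.closure {D | ∃ w : List (Fin N × ℕ), (w.map Prod.fst).Sublist (i :: l) ∧
          D = (factorWord (fun r => coeffMatrix r X) w, factorWord (fun r => coeffMatrix r Y) w)} :=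
      AddSubgroup.closure_mono fun D ⟨w, hw, hD⟩ => ⟨w, hw.cons i, hD⟩
    have hadd : ∀ C D E : Matrix (Fin N → Fin N) (Fin N → Fin N) (PowerSeries A),
        coeffMatrix s (C + D - E) = coeffMatrix s C + coeffMatrix s D - coeffMatrix s E :=
      fun C D E => by ext p q; simp [coeffMatrix]
    change (coeffMatrix s (_ + (operatorProduct X l j).map derivU
        - inFactor X i * operatorProduct X l j), coeffMatrix s (_ +
        (operatorProduct Y l j).map derivU - inFactor Y i * operatorProduct Y l j)) ∈ _
    rw [hadd, hadd, ← Prod.mk_sub_mk, ← Prod.mk_add_mk]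
    refine sub_mem (add_mem ?_ ?_) ?_
    · cases j with
      | zero =>
        have h0 : coeffMatrix s (0 : Matrix (Fin N → Fin N) (Fin N → Fin N) (PowerSeries A))
            = 0 := by
          ext p q
          simp [coeffMatrix]
        change (coeffMatrix s 0, coeffMatrix s 0) ∈ _
        rw [h0]
        exact zero_mem _
      | succ r => exact hle (ih r s)
    -- Differentiation multiplies a lower coefficient by an integer that is the same in both
    -- components.
    · cases s with
      | zero =>
        rw [coeffMatrix_derivU_zero, coeffMatrix_derivU_zero]
        exact zero_mem _
      | succ s =>
        rw [coeffMatrix_derivU_succ, coeffMatrix_derivU_succ, ← Prod.smul_mk]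
        exact zsmul_mem (hle (ih j s)) _
    · rw [coeffMatrix_mul, coeffMatrix_mul]
      have hsum : ∀ f g : ℕ × ℕ → Matrix (Fin N → Fin N) (Fin N → Fin N) A,
          (∑ x ∈ Finset.HasAntidiagonal.antidiagonal s, f x, ∑ x ∈ Finset.HasAntidiagonal.antidiagonal s, g x)
            = ∑ x ∈ Finset.HasAntidiagonal.antidiagonal s, (f x, g x) := fun f g => by
        ext <;> simp [Prod.fst_sum, Prod.snd_sum]
      rw [hsum]
      refine sum_mem fun x _ => ?_
      rw [coeffMatrix_inFactor, coeffMatrix_inFactor, ← Prod.mk_mul_mk]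
      -- Left multiplication by the pair of letters `(i, x.1)` is additive and lengthens each word
      -- for `l` to a word for `i :: l`.
      refine AddSubgroup.closure_induction ?_ ?_ ?_ ?_ (ih j x.2)
      · rintro D ⟨w, hw, rfl⟩
        refine AddSubgroup.subset_closure ⟨(i, x.1) :: w, by simpa using hw, ?_⟩
        simp [factorWord]
      · rw [mul_zero]
        exact zero_mem _
      · intro D E _ _ hD hE
        rw [mul_add]
        exact add_mem hD hE
      · intro D _ hD
        rw [mul_neg]
        exact neg_mem hD

end OperatorProducts

/-! ### The identity for `tau` on the transfer matrices -/

section Transfer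

variable {N : ℕ}

theorem coeffMatrix_shiftedCurrent_zero (K : Matrix (Fin N) (Fin N) ℂ) (a b : Fin N) :
    coeffMatrix 0 (shiftedCurrent K) a b = algebraMap ℂ _ (K a b) := by
  simp [coeffMatrix, shiftedCurrent, currentSeries, PowerSeries.algebraMap_apply]

theorem coeffMatrix_shiftedCurrent_succ (K : Matrix (Fin N) (Fin N) ℂ) (s : ℕ) (a b : Fin N) :
    coeffMatrix (s + 1) (shiftedCurrent K) a b = UniversalEnvelopingAlgebra.ι ℂ
      (Matrix.single b a ((Polynomial.X : Polynomial ℂ) ^ s)) := by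
  simp [coeffMatrix, shiftedCurrent, currentSeries, PowerSeries.algebraMap_apply]

/-- On the current part the two transpositions cancel; the constant part consists of scalars, where
only the matrix transposition is felt. -/
theorem tauTranspose_shiftedCurrent (K : Matrix (Fin N) (Fin N) ℂ) (s : ℕ) :
    tauTranspose (coeffMatrix s (shiftedCurrent K))
      = coeffMatrix s (shiftedCurrent K.transpose) := by
  ext a b
  cases s with
  | zero =>
    rw [tauTranspose, coeffMatrix_shiftedCurrent_zero, coeffMatrix_shiftedCurrent_zero,
      tau_algebraMap, Matrix.transpose_apply]
  | succ s =>
    rw [tauTranspose, coeffMatrix_shiftedCurrent_succ, coeffMatrix_shiftedCurrent_succ, tau_ι,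
      Matrix.transpose_single]

/-- This is the bracket of matrix units, with the powers of `x` adding up. If one index is zero,
that coefficient is a scalar and `B = 0` serves. -/
theorem shiftedCurrent_commutator (K : Matrix (Fin N) (Fin N) ℂ) (s r : ℕ) :
    ∃ B : Matrix (Fin N) (Fin N) (EnvGl N (Polynomial ℂ)), ∀ a b c d,
      coeffMatrix s (shiftedCurrent K) a b * coeffMatrix r (shiftedCurrent K) c d
          - coeffMatrix r (shiftedCurrent K) c d * coeffMatrix s (shiftedCurrent K) a b
        = (if a = d then B c b else 0) - (if c = b then B a d else 0) := by
  rcases s with _ | s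
  · refine ⟨0, fun a b c d => ?_⟩
    rw [coeffMatrix_shiftedCurrent_zero, Algebra.commutes]
    simp
  rcases r with _ | r
  · refine ⟨0, fun a b c d => ?_⟩
    rw [coeffMatrix_shiftedCurrent_zero, Algebra.commutes]
    simp
  refine ⟨fun a b => UniversalEnvelopingAlgebra.ι ℂ
    (Matrix.single b a ((Polynomial.X : Polynomial ℂ) ^ (s + r))), fun a b c d => ?_⟩
  simp only [coeffMatrix_shiftedCurrent_succ]
  rw [← Ring.lie_def, ← LieHom.map_lie, Ring.lie_def, map_sub]
  congr 1
  · split_ifs with h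
    · subst h
      rw [Matrix.single_mul_single_same, pow_add]
    · rw [Matrix.single_mul_single_of_ne _ _ _ _ h, map_zero]
  · split_ifs with h
    · subst h
      rw [Matrix.single_mul_single_same, ← pow_add, add_comm r]
    · rw [Matrix.single_mul_single_of_ne _ _ _ _ h, map_zero]

theorem coeff_gaudinOperator (K : Matrix (Fin N) (Fin N) ℂ) (j s : ℕ) :
    PowerSeries.coeff s (gaudinOperator K j)
      = (coeffMatrix s (operatorProduct (shiftedCurrent K) (List.finRange N) j)
        * skewProjector N _).trace := by
  simp only [gaudinOperator, Matrix.trace, Matrix.diag, Matrix.mul_apply, map_sum]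
  refine Finset.sum_congr rfl fun p _ => Finset.sum_congr rfl fun q _ => ?_
  rw [skewProjector, skewProjector, PowerSeries.algebraMap_apply, PowerSeries.coeff_mul_C]
  rfl

/-- `τ(G_{k,K}(u)) = G_{k,Kᵀ}(u)`. -/
theorem tau_coeff_gaudinTransfer (K : Matrix (Fin N) (Fin N) ℂ) (k s : ℕ) :
    tau N (Polynomial ℂ) (PowerSeries.coeff s (gaudinTransfer K k))
      = PowerSeries.coeff s (gaudinTransfer K.transpose k) := by
  have key : tau N (Polynomial ℂ) (PowerSeries.coeff s (gaudinOperator K (N - k)))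
      = PowerSeries.coeff s (gaudinOperator K.transpose (N - k)) := by
    rw [coeff_gaudinOperator, coeff_gaudinOperator]
    -- The claim is additive in the pair for `K` and its transpose, so words suffice; their factors
    -- are distinct as sublists of `List.finRange N`.
    refine AddSubgroup.closure_induction (p := fun D _ =>
      tau N (Polynomial ℂ) (D.1 * skewProjector N _).trace = (D.2 * skewProjector N _).trace)
      ?_ ?_ ?_ ?_ (operatorProduct_coeff_mem_closure (shiftedCurrent K)
        (shiftedCurrent K.transpose) (List.finRange N) (N - k) s)
    · rintro D ⟨w, hw, rfl⟩
      have := tau_trace_factorWord (Z := fun r => coeffMatrix r (shiftedCurrent K))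
        (fun s r => by
          simp only [tauTranspose_shiftedCurrent]
          exact shiftedCurrent_commutator K.transpose s r)
        (hw.nodup (List.nodup_finRange N))
      simpa only [tauTranspose_shiftedCurrent] using this
    · simp [tau_zero]
    · intro D E _ _ hD hE
      simp only [Prod.fst_add, Prod.snd_add, Matrix.add_mul, Matrix.trace_add, tau_add, hD, hE]
    · intro D _ hD
      simp only [Prod.fst_neg, Prod.snd_neg, Matrix.neg_mul, Matrix.trace_neg, tau_neg, hD]
  unfold gaudinTransfer
  rcases neg_one_pow_eq_or (PowerSeries (EnvGl N (Polynomial ℂ))) k with h | h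
  · rw [h, one_mul, one_mul, key]
  · rw [h, neg_one_mul, neg_one_mul, map_neg, map_neg, tau_neg, key]

end Transfer

/-! ### The universal enveloping algebra is generated by the Lie algebra -/

/-- The elements satisfying `p` form a subalgebra through which `ι` factors; by the universal
property the lifted map followed by the inclusion is the identity. -/
theorem universalEnvelopingAlgebra_induction {L : Type*} [LieRing L] [LieAlgebra ℂ L]
    {p : UniversalEnvelopingAlgebra ℂ L → Prop}
    (algebraMap : ∀ c, p (algebraMap ℂ _ c)) (ι : ∀ x, p (UniversalEnvelopingAlgebra.ι ℂ x))
    (mul : ∀ X Y, p X → p Y → p (X * Y)) (add : ∀ X Y, p X → p Y → p (X + Y))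
    (X : UniversalEnvelopingAlgebra ℂ L) : p X := by
  let S : Subalgebra ℂ (UniversalEnvelopingAlgebra ℂ L) :=
    { carrier := {X | p X}
      mul_mem' := fun hX hY => mul _ _ hX hY
      add_mem' := fun hX hY => add _ _ hX hY
      algebraMap_mem' := algebraMap }
  let f : L →ₗ⁅ℂ⁆ S :=
    { toFun := fun x => ⟨UniversalEnvelopingAlgebra.ι ℂ x, ι x⟩
      map_add' := fun x y => Subtype.ext (map_add _ x y)
      map_smul' := fun c x => Subtype.ext (map_smul _ c x)
      map_lie' := fun {x y} => Subtype.ext (LieHom.map_lie _ x y) }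
  have h : S.val.comp (UniversalEnvelopingAlgebra.lift ℂ f) = AlgHom.id ℂ _ := by
    apply UniversalEnvelopingAlgebra.hom_ext
    ext x
    change ((UniversalEnvelopingAlgebra.lift ℂ f (UniversalEnvelopingAlgebra.ι ℂ x) : S) :
      UniversalEnvelopingAlgebra ℂ L) = _
    rw [UniversalEnvelopingAlgebra.lift_ι_apply]
    rfl
  have := (UniversalEnvelopingAlgebra.lift ℂ f X).2
  rwa [show ((UniversalEnvelopingAlgebra.lift ℂ f X : S) : UniversalEnvelopingAlgebra ℂ L) = X
    from DFunLike.congr_fun h X] at this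

/-- A bilinear form that is contravariant for the Lie algebra is contravariant for the enveloping
algebra. -/
theorem contravariant_of_lie {N : ℕ} {R : Type} [CommRing R] [Algebra ℂ R] {W : Type*}
    [AddCommGroup W] [Module ℂ W] (ρ : LieGl N R →ₗ⁅ℂ⁆ Module.End ℂ W)
    (S : LinearMap.BilinForm ℂ W) (h : ∀ x w₁ w₂, S (ρ x w₁) w₂ = S w₁ (ρ x.transpose w₂))
    (X : EnvGl N R) : ∀ w₁ w₂, S (UniversalEnvelopingAlgebra.lift ℂ ρ X w₁) w₂
      = S w₁ (UniversalEnvelopingAlgebra.lift ℂ ρ (tau N R X) w₂) := by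
  induction X using universalEnvelopingAlgebra_induction with
  | algebraMap c =>
    intro w₁ w₂
    rw [tau_algebraMap, AlgHom.commutes]
    simp [Module.algebraMap_end_apply]
  | ι x =>
    intro w₁ w₂
    rw [tau_ι, UniversalEnvelopingAlgebra.lift_ι_apply, UniversalEnvelopingAlgebra.lift_ι_apply, h]
  | mul X Y hX hY =>
    intro w₁ w₂
    rw [tau_mul, map_mul, map_mul, Module.End.mul_apply, Module.End.mul_apply, hX, hY]
  | add X Y hX hY =>
    intro w₁ w₂
    rw [tau_add, map_add, map_add, LinearMap.add_apply, LinearMap.add_apply, map_add,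
      LinearMap.add_apply, map_add, hX, hY]

/-! ### Submodules generated by singular weight vectors -/

section LowerWords

variable {N : ℕ} {W : Type*} [AddCommGroup W] [Module ℂ W]

/-- The vectors obtained from `v` by applying generators `e_ab` with `b < a`. -/
inductive LowerWord (ρ : LieGl N ℂ →ₗ⁅ℂ⁆ Module.End ℂ W) (v : W) : W → Prop
  | base : LowerWord ρ v v
  | step {a b : Fin N} (hab : b < a) {w : W} (hw : LowerWord ρ v w) :
      LowerWord ρ v (ρ (Matrix.single a b 1) w)

variable {ρ : LieGl N ℂ →ₗ⁅ℂ⁆ Module.End ℂ W} {Λ : Fin N → ℂ} {v : W}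

theorem lieHom_apply_mem_of_single {P : Submodule ℂ W} {w : W}
    (h : ∀ a b, ρ (Matrix.single a b 1) w ∈ P) (x : LieGl N ℂ) : ρ x w ∈ P := by
  rw [Matrix.matrix_eq_sum_single x, map_sum, LinearMap.sum_apply]
  refine sum_mem fun a _ => ?_
  rw [map_sum, LinearMap.sum_apply]
  refine sum_mem fun b _ => ?_
  rw [← mul_one (x a b), ← smul_eq_mul, ← Matrix.smul_single, map_smul, LinearMap.smul_apply]
  exact P.smul_mem _ (h a b)

/-- The span of the lower words on a singular weight vector is a submodule for `gl_N`. -/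
theorem lieHom_apply_mem_span_lowerWord
    (hweight : ∀ a, ρ (Matrix.single a a 1) v = Λ a • v)
    (hsing : ∀ a b, a < b → ρ (Matrix.single a b 1) v = 0) (x : LieGl N ℂ) {w : W}
    (hw : w ∈ Submodule.span ℂ {w | LowerWord ρ v w}) :
    ρ x w ∈ Submodule.span ℂ {w | LowerWord ρ v w} := by
  have hlow : ∀ {a b : Fin N}, b < a → ∀ w ∈ Submodule.span ℂ {w | LowerWord ρ v w},
      ρ (Matrix.single a b 1) w ∈ Submodule.span ℂ {w | LowerWord ρ v w} := by
    intro a b hab w hw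
    induction hw using Submodule.span_induction with
    | mem w hw => exact Submodule.subset_span (LowerWord.step hab hw)
    | zero => rw [map_zero]; exact zero_mem _
    | add y z _ _ hy hz => rw [map_add]; exact add_mem hy hz
    | smul c y _ hy => rw [map_smul]; exact Submodule.smul_mem _ c hy
  -- The element `x` is moved past the outermost lowering operator. The commutator is another
  -- element of `gl_N`, so the induction must treat all `x` at once.
  have hword : ∀ w, LowerWord ρ v w → ∀ x : LieGl N ℂ,
      ρ x w ∈ Submodule.span ℂ {w | LowerWord ρ v w} := by
    intro w hw
    induction hw with
    | base =>
      refine lieHom_apply_mem_of_single fun a b => ?_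
      rcases lt_trichotomy a b with h | rfl | h
      · rw [hsing a b h]
        exact zero_mem _
      · rw [hweight]
        exact Submodule.smul_mem _ _ (Submodule.subset_span LowerWord.base)
      · exact Submodule.subset_span (LowerWord.base.step h)
    | @step a b hab w hw ih =>
      intro x
      have hc : ρ x (ρ (Matrix.single a b 1) w)
          = ρ (Matrix.single a b 1) (ρ x w) + ρ ⁅x, (Matrix.single a b 1 : LieGl N ℂ)⁆ w := by
        rw [LieHom.map_lie, Ring.lie_def, LinearMap.sub_apply, Module.End.mul_apply,
          Module.End.mul_apply]
        abel
      rw [hc]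
      exact add_mem (hlow hab _ (ih x)) (ih _)
  induction hw using Submodule.span_induction with
  | mem w hw => exact hword w hw x
  | zero => rw [map_zero]; exact zero_mem _
  | add y z _ _ hy hz => rw [map_add]; exact add_mem hy hz
  | smul c y _ hy => rw [map_smul]; exact Submodule.smul_mem _ c hy

/-- Two linear functionals that agree on the singular weight vector and vanish on the images of the
lowering operators agree on the span of the lower words. -/
theorem eqOn_span_lowerWord {F G : W →ₗ[ℂ] ℂ} (hv : F v = G v)
    (hF : ∀ {a b : Fin N}, b < a → ∀ w, LowerWord ρ v w → F (ρ (Matrix.single a b 1) w) = 0)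
    (hG : ∀ {a b : Fin N}, b < a → ∀ w, LowerWord ρ v w → G (ρ (Matrix.single a b 1) w) = 0)
    {w : W} (hw : w ∈ Submodule.span ℂ {w | LowerWord ρ v w}) : F w = G w := by
  induction hw using Submodule.span_induction with
  | mem w hw =>
    cases hw with
    | base => exact hv
    | step hab hw => rw [hF hab _ hw, hG hab _ hw]
  | zero => rw [map_zero, map_zero]
  | add y z _ _ hy hz => rw [map_add, map_add, hy, hz]
  | smul c y _ hy => rw [map_smul, map_smul, hy]

/-- The diagonal element of `gl_N` with `[H, e_ab] = (b - a) e_ab`. -/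
def gradingElement (N : ℕ) : LieGl N ℂ := Matrix.diagonal fun a => -((a : ℕ) : ℂ)

theorem gradingElement_apply (hweight : ∀ a, ρ (Matrix.single a a 1) v = Λ a • v) :
    ρ (gradingElement N) v = (∑ a : Fin N, -((a : ℕ) : ℂ) * Λ a) • v := by
  have : gradingElement N = ∑ a : Fin N, (-((a : ℕ) : ℂ)) • (Matrix.single a a 1 : LieGl N ℂ) := by
    simp only [Matrix.smul_single, smul_eq_mul, mul_one]
    ext a b
    rw [Matrix.sum_apply]
    simp only [gradingElement, Matrix.diagonal_apply, Matrix.single_apply]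
    rcases eq_or_ne a b with rfl | h
    · rw [Finset.sum_eq_single a] <;> simp +contextual
    · rw [if_neg h, Finset.sum_eq_zero]
      rintro c -
      rw [if_neg]
      rintro ⟨rfl, h'⟩
      exact h h'
  rw [this, map_sum, LinearMap.sum_apply, Finset.sum_smul]
  refine Finset.sum_congr rfl fun a _ => ?_
  rw [map_smul, LinearMap.smul_apply, hweight, smul_smul]

theorem gradingElement_lie (a b : Fin N) :
    ⁅gradingElement N, (Matrix.single a b 1 : LieGl N ℂ)⁆
      = (((b : ℕ) : ℂ) - ((a : ℕ) : ℂ)) • (Matrix.single a b 1 : LieGl N ℂ) := by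
  rw [Ring.lie_def]
  ext i j
  simp only [gradingElement, Matrix.sub_apply, Matrix.diagonal_mul, Matrix.mul_diagonal,
    Matrix.smul_apply, Matrix.single_apply]
  split_ifs with h
  · obtain ⟨rfl, rfl⟩ := h
    simp
    ring
  · simp

theorem gradingElement_apply_single {w : W} {μ : ℂ} (hw : ρ (gradingElement N) w = μ • w)
    (a b : Fin N) : ρ (gradingElement N) (ρ (Matrix.single a b 1) w)
      = (μ + (((b : ℕ) : ℂ) - ((a : ℕ) : ℂ))) • ρ (Matrix.single a b 1) w := by
  have hc : ρ (gradingElement N) (ρ (Matrix.single a b 1) w)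
      = ρ (Matrix.single a b 1) (ρ (gradingElement N) w)
        + ρ ⁅gradingElement N, (Matrix.single a b 1 : LieGl N ℂ)⁆ w := by
    rw [LieHom.map_lie, Ring.lie_def, LinearMap.sub_apply, Module.End.mul_apply,
      Module.End.mul_apply]
    abel
  rw [hc, hw, gradingElement_lie, map_smul, map_smul, LinearMap.smul_apply, ← add_smul]

/-- A lower word is an eigenvector of the grading element; its eigenvalue differs from that of the
singular weight vector by a natural number. -/
theorem LowerWord.grading {w : W} (hw : LowerWord ρ v w)
    (hweight : ∀ a, ρ (Matrix.single a a 1) v = Λ a • v) :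
    ∃ d : ℕ, ρ (gradingElement N) w = ((∑ a : Fin N, -((a : ℕ) : ℂ) * Λ a) - d) • w := by
  induction hw with
  | base => exact ⟨0, by rw [gradingElement_apply hweight]; simp⟩
  | @step a b hab w hw ih =>
    obtain ⟨d, hd⟩ := ih
    refine ⟨d + (a - b), ?_⟩
    rw [gradingElement_apply_single hd]
    congr 1
    have : ((b : ℕ)) ≤ (a : ℕ) := hab.le
    push_cast [this]
    ring

/-- The eigenvalue of the grading element on a nonempty lower word differs from that on the singular
weight vector. -/
theorem LowerWord.grading_step {a b : Fin N} (hab : b < a) {w : W} (hw : LowerWord ρ v w)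
    (hweight : ∀ a, ρ (Matrix.single a a 1) v = Λ a • v) :
    ∃ μ : ℂ, μ ≠ ∑ a : Fin N, -((a : ℕ) : ℂ) * Λ a ∧
      ρ (gradingElement N) (ρ (Matrix.single a b 1) w) = μ • ρ (Matrix.single a b 1) w := by
  obtain ⟨d, hd⟩ := hw.grading hweight
  refine ⟨_, fun h => ?_, gradingElement_apply_single hd a b⟩
  -- Equal eigenvalues would force `d + a = b`, against `b < a`.
  have h1 : ((d + (a : ℕ) : ℕ) : ℂ) = ((b : ℕ) : ℂ) := by
    push_cast
    linear_combination -h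
  have h2 : d + (a : ℕ) = b := by exact_mod_cast h1
  have h3 : (b : ℕ) < a := hab
  omega

/-- The functional that takes the value one at the singular weight vector and annihilates the other
eigenspaces of the grading element. -/
theorem exists_vacuum_functional (hv : v ≠ 0)
    (hweight : ∀ a, ρ (Matrix.single a a 1) v = Λ a • v) :
    ∃ φ : W →ₗ[ℂ] ℂ, φ v = 1 ∧ ∀ (μ : ℂ) (w : W), ρ (gradingElement N) w = μ • w →
      μ ≠ ∑ a : Fin N, -((a : ℕ) : ℂ) * Λ a → φ w = 0 := by
  set l := ∑ a : Fin N, -((a : ℕ) : ℂ) * Λ a with hl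
  set H := ρ (gradingElement N)
  have hvH : v ∈ Module.End.eigenspace H l :=
    Module.End.mem_eigenspace_iff.2 (gradingElement_apply hweight)
  have hvn : v ∉ ⨆ μ, ⨆ (_ : μ ≠ l), Module.End.eigenspace H μ := fun h =>
    hv (Submodule.disjoint_def.1 (Module.End.eigenspaces_iSupIndep H l) v hvH h)
  obtain ⟨f, hf, hle⟩ := Submodule.exists_le_ker_of_notMem hvn
  refine ⟨(f v)⁻¹ • f, by simp [hf], fun μ w hw hμ => ?_⟩
  have : w ∈ LinearMap.ker f :=
    hle (Submodule.mem_iSup_of_mem μ (Submodule.mem_iSup_of_mem hμ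
      (Module.End.mem_eigenspace_iff.2 hw)))
  rw [LinearMap.smul_apply, LinearMap.mem_ker.1 this, smul_zero]

end LowerWords

/-! ### The Shapovalov form -/

section Shapovalov

variable {N : ℕ} {M : Type*} [AddCommGroup M] [Module ℂ M] [LieRingModule (LieGl N ℂ) M]
  {Λ : Fin N → ℂ} {v : M}

theorem IsHighestWeight.mem_of_stable (hv : IsHighestWeight Λ v) {P : Submodule ℂ M} (hP : v ∈ P)
    (h : ∀ (x : LieGl N ℂ), ∀ w ∈ P, ⁅x, w⁆ ∈ P) (w : M) : w ∈ P := by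
  let Q : LieSubmodule ℂ (LieGl N ℂ) M := { P with lie_mem := fun {x w} hw => h x w hw }
  have hQ : LieSubmodule.lieSpan ℂ (LieGl N ℂ) {v} ≤ Q :=
    LieSubmodule.lieSpan_le.2 (Set.singleton_subset_iff.2 hP)
  rw [hv.generates] at hQ
  exact hQ (LieSubmodule.mem_top w)

/-- A contravariant form on a highest weight module is determined by the functional that it assigns
to the highest weight vector. -/
theorem IsHighestWeight.bilinForm_ext (hv : IsHighestWeight Λ v) {S T : LinearMap.BilinForm ℂ M}
    (hS : ∀ (x : LieGl N ℂ) w₁ w₂, S ⁅x, w₁⁆ w₂ = S w₁ ⁅x.transpose, w₂⁆)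
    (hT : ∀ (x : LieGl N ℂ) w₁ w₂, T ⁅x, w₁⁆ w₂ = T w₁ ⁅x.transpose, w₂⁆)
    (h : ∀ w, S v w = T v w) : S = T := by
  refine LinearMap.ext fun w => ?_
  refine hv.mem_of_stable (P := LinearMap.eqLocus S T) (LinearMap.ext h) (fun x w hw => ?_) w
  refine LinearMap.ext fun w' => ?_
  rw [hS, hT, LinearMap.mem_eqLocus.1 hw]

variable [LieModule ℂ (LieGl N ℂ) M]

/-- The action of `gl_N` on `M ⊕ M*`, where `M*` carries the action `(x ξ)(w) = ξ(xᵀ w)`. -/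
def dualPairAction (N : ℕ) (M : Type*) [AddCommGroup M] [Module ℂ M]
    [LieRingModule (LieGl N ℂ) M] [LieModule ℂ (LieGl N ℂ) M] :
    LieGl N ℂ →ₗ⁅ℂ⁆ Module.End ℂ (M × Module.Dual ℂ M) where
  toFun x := (LieModule.toEnd ℂ (LieGl N ℂ) M x).prodMap
    (LieModule.toEnd ℂ (LieGl N ℂ) M x.transpose).dualMap
  map_add' x y := by
    ext w <;> simp [Matrix.transpose_add]
  map_smul' c x := by
    ext w <;> simp [Matrix.transpose_smul]
  map_lie' := by
    intro x y
    have h : (⁅x, y⁆ : LieGl N ℂ).transpose = ⁅y.transpose, x.transpose⁆ := by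
      rw [Ring.lie_def, Ring.lie_def, Matrix.transpose_sub, Matrix.transpose_mul,
        Matrix.transpose_mul]
    refine LinearMap.ext fun w => Prod.ext ?_ (LinearMap.ext fun w' => ?_)
    · simp [Ring.lie_def (R := Module.End ℂ (M × Module.Dual ℂ M)), -Matrix.transpose_sub]
    · rw [h]
      simp [Ring.lie_def (R := Module.End ℂ (M × Module.Dual ℂ M))]

theorem dualPairAction_apply (x : LieGl N ℂ) (w : M × Module.Dual ℂ M) :
    dualPairAction N M x w
      = (⁅x, w.1⁆, w.2 ∘ₗ LieModule.toEnd ℂ (LieGl N ℂ) M x.transpose) :=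
  rfl

/-- Lowering operators alone generate the module: the span of the lower words is stable and contains
`v`. This plays the role of the Poincaré–Birkhoff–Witt theorem. -/
theorem IsHighestWeight.mem_span_lowerWord (hv : IsHighestWeight Λ v) (w : M) :
    w ∈ Submodule.span ℂ {w | LowerWord (LieModule.toEnd ℂ (LieGl N ℂ) M) v w} :=
  hv.mem_of_stable (Submodule.subset_span LowerWord.base)
    (fun x _ hw => lieHom_apply_mem_span_lowerWord (ρ := LieModule.toEnd ℂ (LieGl N ℂ) M)
      hv.weight hv.singular x hw) w

theorem IsShapovalovForm.lie {S : LinearMap.BilinForm ℂ M} (hS : IsShapovalovForm (N := N) v S)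
    (x : LieGl N ℂ) (w₁ w₂ : M) : S ⁅x, w₁⁆ w₂ = S w₁ ⁅x.transpose, w₂⁆ := by
  have := hS.contravariant (UniversalEnvelopingAlgebra.ι ℂ x) w₁ w₂
  rwa [tau_ι, UniversalEnvelopingAlgebra.lift_ι_apply,
    UniversalEnvelopingAlgebra.lift_ι_apply] at this

/-- Contravariance moves a lowering operator in the second argument to a raising operator on `v`,
which vanishes. Hence the functional `S v` is determined by its value at `v`, and it determines `S`.
-/
theorem IsHighestWeight.shapovalovForm_unique (hv : IsHighestWeight Λ v)
    {S T : LinearMap.BilinForm ℂ M} (hS : IsShapovalovForm (N := N) v S)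
    (hT : IsShapovalovForm (N := N) v T) : S = T := by
  have key : ∀ {S : LinearMap.BilinForm ℂ M}, IsShapovalovForm (N := N) v S →
      ∀ {a b : Fin N}, b < a → ∀ w, S v ⁅(Matrix.single a b 1 : LieGl N ℂ), w⁆ = 0 := by
    intro S hS a b hab w
    have := hS.lie (Matrix.single b a 1) v w
    rw [Matrix.transpose_single, hv.singular b a hab, map_zero, LinearMap.zero_apply] at this
    exact this.symm
  refine hv.bilinForm_ext hS.lie hT.lie fun w => ?_
  refine eqOn_span_lowerWord (ρ := LieModule.toEnd ℂ (LieGl N ℂ) M) (F := S v) (G := T v)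
    (by rw [hS.normalized, hT.normalized]) (fun hab w _ => key hS hab w)
    (fun hab w _ => key hT hab w) (hv.mem_span_lowerWord w)

/-- The functional `φ` on a highest weight module with `φ(v) = 1` that annihilates the images of the
lowering operators. -/
theorem IsHighestWeight.exists_functional (hv : IsHighestWeight Λ v) :
    ∃ φ : M →ₗ[ℂ] ℂ, φ v = 1 ∧
      (∀ {a b : Fin N}, b < a → ∀ w, φ ⁅(Matrix.single a b 1 : LieGl N ℂ), w⁆ = 0) ∧
      ∀ a w, φ ⁅(Matrix.single a a 1 : LieGl N ℂ), w⁆ = Λ a * φ w := by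
  obtain ⟨φ, hφv, hφ⟩ := exists_vacuum_functional (ρ := LieModule.toEnd ℂ (LieGl N ℂ) M)
    hv.ne_zero hv.weight
  refine ⟨φ, hφv, fun {a b} hab w => ?_, fun a w => ?_⟩
  · have hw := hv.mem_span_lowerWord w
    induction hw using Submodule.span_induction with
    | mem w hw =>
      obtain ⟨μ, hμ, h⟩ := LowerWord.grading_step hab hw hv.weight
      exact hφ μ _ h hμ
    | zero => rw [lie_zero, map_zero]
    | add y z _ _ hy hz => rw [lie_add, map_add, hy, hz, add_zero]
    | smul c y _ hy => rw [lie_smul, map_smul, hy, smul_zero]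
  · have hw := hv.mem_span_lowerWord w
    induction hw using Submodule.span_induction with
    | mem w hw =>
      cases hw with
      | base => rw [hv.weight, map_smul, smul_eq_mul]
      | @step c d hcd w hw =>
        obtain ⟨μ, hμ, h⟩ := LowerWord.grading_step hcd hw hv.weight
        -- A diagonal unit preserves the grading eigenvalue, so `φ` vanishes on a nonempty lower
        -- word both before and after its action.
        have h' := gradingElement_apply_single h a a
        rw [sub_self, add_zero] at h'
        rw [hφ μ _ h hμ, mul_zero]
        exact hφ μ _ h' hμ
    | zero => rw [lie_zero, map_zero, mul_zero]
    | add y z _ _ hy hz => rw [lie_add, map_add, hy, hz, map_add, mul_add]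
    | smul c y _ hy => rw [lie_smul, map_smul, hy, map_smul, smul_eq_mul, smul_eq_mul]; ring

/-- A contravariant form amounts to a homomorphism from `M` to its transposed dual. Such a map is
obtained from its graph, which avoids checking that a formula on words is well defined. -/
theorem IsHighestWeight.exists_shapovalovForm (hv : IsHighestWeight Λ v) :
    ∃ S : LinearMap.BilinForm ℂ M, IsShapovalovForm (N := N) v S := by
  obtain ⟨φ, hφv, hlow, hdiag⟩ := hv.exists_functional
  -- the submodule of `M ⊕ M*` generated by `(v, φ)` is the graph of a map `M → M*`
  set Γ := Submodule.span ℂ {w | LowerWord (dualPairAction N M) (v, φ) w} with hΓ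
  have hΓv : (v, φ) ∈ Γ := Submodule.subset_span LowerWord.base
  -- Transposition exchanges raising and lowering, so `φ` is singular of weight `Λ` in the dual, and
  -- the same holds for the pair.
  have hstable : ∀ x : LieGl N ℂ, ∀ w ∈ Γ, dualPairAction N M x w ∈ Γ := by
    refine fun x w hw => lieHom_apply_mem_span_lowerWord (Λ := Λ) (fun a => ?_)
      (fun a b hab => ?_) x hw
    · rw [dualPairAction_apply, Matrix.transpose_single]
      refine Prod.ext (hv.weight a) (LinearMap.ext fun w => ?_)
      simpa using hdiag a w
    · rw [dualPairAction_apply, Matrix.transpose_single]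
      refine Prod.ext (hv.singular a b hab) (LinearMap.ext fun w => ?_)
      simpa using hlow hab w
  -- Both sides agree at `(v, φ)` and vanish after a lowering operator. This gives single-valuedness
  -- now and symmetry of the form at the end.
  have hsymm : ∀ w ∈ Γ, φ w.1 = w.2 v := by
    intro w hw
    refine eqOn_span_lowerWord (ρ := dualPairAction N M) (v := (v, φ))
      (F := φ ∘ₗ LinearMap.fst ℂ M (Module.Dual ℂ M))
      (G := (Module.Dual.eval ℂ M v) ∘ₗ LinearMap.snd ℂ M (Module.Dual ℂ M)) rfl
      (fun {a b} hab w _ => ?_) (fun {a b} hab w _ => ?_) hw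
    · exact hlow hab w.1
    · change w.2 ⁅(Matrix.single a b 1 : LieGl N ℂ).transpose, v⁆ = 0
      rw [Matrix.transpose_single, hv.singular b a hab, map_zero]
  have hinj : ∀ ξ, (0, ξ) ∈ Γ → ξ = 0 := by
    intro ξ hξ
    refine LinearMap.ext fun w => ?_
    -- The common kernel of all `ξ` with `(0, ξ) ∈ Γ` contains `v` by `hsymm` and is stable, so it
    -- is everything.
    let P : Submodule ℂ M :=
      { carrier := {w | ∀ ξ, (0, ξ) ∈ Γ → ξ w = 0}
        zero_mem' := fun ξ _ => map_zero ξ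
        add_mem' := fun {y z} hy hz ξ h => by rw [map_add, hy ξ h, hz ξ h, add_zero]
        smul_mem' := fun c y hy ξ h => by rw [map_smul, hy ξ h, smul_zero] }
    refine hv.mem_of_stable (P := P) (fun ξ h => ?_) (fun x w hw ξ h => ?_) w ξ hξ
    · rw [← hsymm _ h, map_zero]
    · have := hstable x.transpose _ h
      rw [dualPairAction_apply, lie_zero, Matrix.transpose_transpose] at this
      exact hw _ this
  have hsurj : ∀ w, ∃ ξ, (w, ξ) ∈ Γ := by
    intro w
    have : w ∈ Γ.map (LinearMap.fst ℂ M (Module.Dual ℂ M)) := by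
      refine hv.mem_of_stable (P := Γ.map (LinearMap.fst ℂ M (Module.Dual ℂ M)))
        ⟨_, hΓv, rfl⟩ (fun x w hw => ?_) w
      obtain ⟨y, hy, rfl⟩ := hw
      exact ⟨_, hstable x y hy, rfl⟩
    obtain ⟨y, hy, rfl⟩ := this
    exact ⟨y.2, hy⟩
  choose T hT using hsurj
  have huniq : ∀ {w ξ}, (w, ξ) ∈ Γ → T w = ξ := by
    intro w ξ h
    have := Γ.sub_mem (hT w) h
    rw [Prod.mk_sub_mk, sub_self] at this
    exact sub_eq_zero.1 (hinj _ this)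
  let S : LinearMap.BilinForm ℂ M :=
    { toFun := T
      map_add' := fun y z => huniq (Γ.add_mem (hT y) (hT z))
      map_smul' := fun c y => huniq (Γ.smul_mem c (hT y)) }
  have hS : ∀ (x : LieGl N ℂ) w₁ w₂, S ⁅x, w₁⁆ w₂ = S w₁ ⁅x.transpose, w₂⁆ := by
    intro x w₁ w₂
    have := huniq (hstable x _ (hT w₁))
    exact LinearMap.congr_fun this w₂
  have hSv : S v = φ := huniq hΓv
  -- The flipped form is contravariant too, and `hsymm` says that both forms assign the functional
  -- `φ` to `v`.
  have hflip : S = S.flip := by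
    refine hv.bilinForm_ext hS (fun x w₁ w₂ => ?_) (fun w => ?_)
    · rw [LinearMap.BilinForm.flip_apply, LinearMap.BilinForm.flip_apply, hS, Matrix.transpose_transpose]
    · rw [LinearMap.BilinForm.flip_apply, hSv]
      exact hsymm _ (hT w)
  refine ⟨S, ⟨fun w₁ w₂ => ?_, by rw [hSv, hφv], fun X w₁ w₂ => ?_⟩⟩
  · conv_lhs => rw [hflip]
    rfl
  · exact contravariant_of_lie _ S hS X w₁ w₂

end Shapovalov

/-! ### Expansions of rational functions at infinity -/

section Expansions

variable {A : Type*} [Ring A]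

theorem ofPowerSeries_coeff_natCast (G : PowerSeries A) (t : ℕ) :
    (HahnSeries.ofPowerSeries ℤ A G).coeff t = PowerSeries.coeff t G :=
  HahnSeries.ofPowerSeries_apply_coeff G t

theorem ofPowerSeries_coeff_neg (G : PowerSeries A) {t : ℤ} (ht : t < 0) :
    (HahnSeries.ofPowerSeries ℤ A G).coeff t = 0 := by
  have := PowerSeries.coeff_coe G t
  rwa [if_pos ht] at this

theorem laurentAtInfinity_coeff_neg (P : Polynomial A) (j : ℕ) :
    (laurentAtInfinity P).coeff (-(j : ℤ)) = P.coeff j := by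
  rw [laurentAtInfinity, Polynomial.sum_def, HahnSeries.coeff_sum,
    Finset.sum_eq_single j]
  · simp
  · intro i _ hi
    rw [HahnSeries.coeff_single_of_ne]
    omega
  · intro hj
    simp [Polynomial.notMem_support_iff.1 hj]

theorem laurentAtInfinity_coeff_pos (P : Polynomial A) {t : ℤ} (ht : 0 < t) :
    (laurentAtInfinity P).coeff t = 0 := by
  rw [laurentAtInfinity, Polynomial.sum_def, HahnSeries.coeff_sum]
  refine Finset.sum_eq_zero fun i _ => ?_
  rw [HahnSeries.coeff_single_of_ne]
  omega

theorem laurentAtInfinity_add (P Q : Polynomial A) :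
    laurentAtInfinity (P + Q) = laurentAtInfinity P + laurentAtInfinity Q :=
  Polynomial.sum_add_index _ _ _ (by simp) (by simp)

variable [Algebra ℂ A]

theorem coeff_laurentAtInfinity_map_mul (q : Polynomial ℂ) (F : LaurentSeries A) (t : ℤ) :
    (laurentAtInfinity (q.map (algebraMap ℂ A)) * F).coeff t
      = ∑ i ∈ Finset.range (q.natDegree + 1), q.coeff i • F.coeff (t + i) := by
  rw [laurentAtInfinity, Polynomial.sum_over_range' _ (fun n => by simp) (q.natDegree + 1)
    (Nat.lt_succ_of_le Polynomial.natDegree_map_le), Finset.sum_mul, HahnSeries.coeff_sum]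
  refine Finset.sum_congr rfl fun i _ => ?_
  rw [HahnSeries.coeff_single_mul, Polynomial.coeff_map, Algebra.smul_def, sub_neg_eq_add]

/-- Since `u^i` sits in degree `-i`, the equation `q G = P` is a family of linear relations with
complex coefficients, insensitive to the noncommutativity of `A`. -/
theorem isExpansionOfRational_iff {G : PowerSeries A} {P : Polynomial A} {q : Polynomial ℂ} :
    IsExpansionOfRational G P q ↔ ∀ t : ℤ, ∑ i ∈ Finset.range (q.natDegree + 1),
      q.coeff i • (HahnSeries.ofPowerSeries ℤ A G).coeff (t + i) = (laurentAtInfinity P).coeff t := by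
  simp only [← coeff_laurentAtInfinity_map_mul]
  exact ⟨fun h t => by rw [h], fun h => HahnSeries.ext (funext h)⟩

theorem IsExpansionOfRational.add {G H : PowerSeries A} {P Q : Polynomial A} {q : Polynomial ℂ}
    (hG : IsExpansionOfRational G P q) (hH : IsExpansionOfRational H Q q) :
    IsExpansionOfRational (G + H) (P + Q) q := by
  unfold IsExpansionOfRational at *
  rw [map_add, mul_add, hG, hH, laurentAtInfinity_add]

theorem isExpansionOfRational_zero (q : Polynomial ℂ) :
    IsExpansionOfRational (0 : PowerSeries A) 0 q := by
  simp [IsExpansionOfRational, laurentAtInfinity]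

theorem IsExpansionOfRational.neg {G : PowerSeries A} {P : Polynomial A} {q : Polynomial ℂ}
    (hG : IsExpansionOfRational G P q) : IsExpansionOfRational (-G) (-P) q := by
  have h := laurentAtInfinity_add P (-P)
  rw [add_neg_cancel] at h
  have h0 : laurentAtInfinity (0 : Polynomial A) = 0 := by simp [laurentAtInfinity]
  rw [h0] at h
  unfold IsExpansionOfRational at *
  rw [map_neg, mul_neg, hG]
  exact (eq_neg_of_add_eq_zero_right h.symm).symm

/-- The expansion of a scalar rational function times a constant. -/
theorem IsExpansionOfRational.C_mul_map {f : PowerSeries ℂ} {p q : Polynomial ℂ}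
    (h : IsExpansionOfRational f p q) (a : A) :
    IsExpansionOfRational (PowerSeries.C a * PowerSeries.map (algebraMap ℂ A) f)
      (Polynomial.C a * p.map (algebraMap ℂ A)) q := by
  rw [isExpansionOfRational_iff] at h ⊢
  have hco : ∀ t : ℤ, (HahnSeries.ofPowerSeries ℤ A
      (PowerSeries.C a * PowerSeries.map (algebraMap ℂ A) f)).coeff t
        = (HahnSeries.ofPowerSeries ℤ ℂ f).coeff t • a := by
    intro t
    rcases lt_or_ge t 0 with ht | ht
    · rw [ofPowerSeries_coeff_neg _ ht, ofPowerSeries_coeff_neg _ ht, zero_smul]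
    · lift t to ℕ using ht
      rw [ofPowerSeries_coeff_natCast, ofPowerSeries_coeff_natCast, PowerSeries.coeff_C_mul,
        PowerSeries.coeff_map, ← Algebra.commutes, Algebra.smul_def]
  have hP : ∀ t : ℤ, (laurentAtInfinity (Polynomial.C a * p.map (algebraMap ℂ A))).coeff t
      = (laurentAtInfinity p).coeff t • a := by
    intro t
    rcases lt_or_ge 0 t with ht | ht
    · rw [laurentAtInfinity_coeff_pos _ ht, laurentAtInfinity_coeff_pos _ ht, zero_smul]
    · obtain ⟨j, rfl⟩ := Int.exists_eq_neg_ofNat ht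
      rw [laurentAtInfinity_coeff_neg, laurentAtInfinity_coeff_neg, Polynomial.coeff_C_mul,
        Polynomial.coeff_map, ← Algebra.commutes, Algebra.smul_def]
  intro t
  rw [hP, ← h t, Finset.sum_smul]
  refine Finset.sum_congr rfl fun i _ => ?_
  rw [hco, smul_smul, smul_eq_mul]

/-- The coefficients of the numerator lie in any subspace that contains the coefficients of the
expansion. -/
theorem IsExpansionOfRational.coeff_mem {G : PowerSeries A} {P : Polynomial A} {q : Polynomial ℂ}
    (h : IsExpansionOfRational G P q) {V : Submodule ℂ A} (hV : ∀ s, PowerSeries.coeff s G ∈ V)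
    (j : ℕ) : P.coeff j ∈ V := by
  rw [← laurentAtInfinity_coeff_neg, ← isExpansionOfRational_iff.1 h]
  refine sum_mem fun i _ => V.smul_mem _ ?_
  rcases lt_or_ge (-(j : ℤ) + i) 0 with ht | ht
  · rw [ofPowerSeries_coeff_neg _ ht]
    exact zero_mem _
  · obtain ⟨t, ht⟩ := Int.eq_ofNat_of_zero_le ht
    rw [ht, ofPowerSeries_coeff_natCast]
    exact hV t

/-- For scalar polynomials the passage to Laurent series is evaluation at `u`, so multiplicativity
comes for free. -/
theorem laurentAtInfinity_eq_eval₂ (p : Polynomial ℂ) :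
    laurentAtInfinity p = p.eval₂ HahnSeries.C (HahnSeries.single (-1) (1 : ℂ)) := by
  rw [Polynomial.eval₂_eq_sum, laurentAtInfinity]
  refine Finset.sum_congr rfl fun i _ => ?_
  simp only [HahnSeries.single_pow, HahnSeries.C_apply, HahnSeries.single_mul_single]
  simp

theorem laurentAtInfinity_mul (p q : Polynomial ℂ) :
    laurentAtInfinity (p * q) = laurentAtInfinity p * laurentAtInfinity q := by
  simp only [laurentAtInfinity_eq_eval₂, Polynomial.eval₂_mul]

theorem laurentAtInfinity_one : laurentAtInfinity (1 : Polynomial ℂ) = 1 := by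
  simp [laurentAtInfinity_eq_eval₂]

end Expansions

/-! ### Products of simple poles -/

section Poles

/-- The expansion at infinity of `(u - z)⁻¹`. -/
def poleSeries (z : ℂ) : PowerSeries ℂ :=
  PowerSeries.mk fun s => match s with
    | 0 => 0
    | r + 1 => z ^ r

theorem poleSeries_mul (z : ℂ) :
    poleSeries z * (1 - PowerSeries.C z * PowerSeries.X) = PowerSeries.X := by
  rw [mul_sub, mul_one, mul_comm (PowerSeries.C z), ← mul_assoc]
  ext s
  rcases s with _ | _ | s
  · simp [poleSeries]
  · simp [poleSeries, PowerSeries.coeff_succ_mul_X]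
  · rw [map_sub, PowerSeries.coeff_mul_C, PowerSeries.coeff_succ_mul_X, PowerSeries.coeff_X,
      if_neg (by omega)]
    simp [poleSeries, pow_succ]

theorem isExpansionOfRational_poleSeries (z : ℂ) :
    IsExpansionOfRational (poleSeries z) 1 (Polynomial.X - Polynomial.C z) := by
  unfold IsExpansionOfRational
  have h1 := congrArg (HahnSeries.ofPowerSeries ℤ ℂ) (poleSeries_mul z)
  have h2 : (HahnSeries.single (-1 : ℤ) (1 : ℂ)) * HahnSeries.single 1 1 = 1 := by
    rw [HahnSeries.single_mul_single]
    simp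
  simp only [map_mul, map_sub, map_one, HahnSeries.ofPowerSeries_C, HahnSeries.ofPowerSeries_X]
    at h1
  rw [Algebra.algebraMap_self, Polynomial.map_id, laurentAtInfinity_eq_eval₂,
    laurentAtInfinity_one, Polynomial.eval₂_sub, Polynomial.eval₂_X, Polynomial.eval₂_C]
  linear_combination HahnSeries.single (-1 : ℤ) (1 : ℂ) * h1
    + (HahnSeries.C z * HahnSeries.ofPowerSeries ℤ ℂ (poleSeries z) + 1) * h2

/-- The derivation `d/du` on scalar series in `u⁻¹`. -/
def derivUDerivation : Derivation ℂ (PowerSeries ℂ) (PowerSeries ℂ) :=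
  (-PowerSeries.X ^ 2 : PowerSeries ℂ) • PowerSeries.derivative ℂ

theorem derivUDerivation_apply (f : PowerSeries ℂ) : derivUDerivation f = derivU f := by
  rw [derivUDerivation, Derivation.smul_apply, smul_eq_mul, neg_mul, mul_comm, pow_two, ← mul_assoc]
  ext s
  rcases s with _ | _ | s
  · simp [derivU]
  · simp [derivU, PowerSeries.coeff_succ_mul_X]
  · rw [map_neg, PowerSeries.coeff_succ_mul_X, PowerSeries.coeff_succ_mul_X,
      PowerSeries.coeff_derivative]
    simp [derivU, mul_comm]

/-- Differentiate `poleSeries z * (1 - z X) = X`, then cancel `(1 - z X)²` in the domain of scalar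
series. -/
theorem derivUDerivation_poleSeries (z : ℂ) :
    derivUDerivation (poleSeries z) = -(poleSeries z ^ 2) := by
  have h := poleSeries_mul z
  have hd := congrArg (PowerSeries.derivative ℂ) h
  rw [Derivation.leibniz, PowerSeries.derivative_X, map_sub, Derivation.leibniz,
    PowerSeries.derivative_X, PowerSeries.derivative_C, Derivation.map_one_eq_zero] at hd
  simp only [smul_eq_mul, mul_one, mul_zero, add_zero, zero_sub] at hd
  have hy : (1 - PowerSeries.C z * PowerSeries.X : PowerSeries ℂ) ≠ 0 := by
    intro h0
    have := congrArg (PowerSeries.coeff 0) h0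
    simp at this
  refine mul_left_cancel₀ (pow_ne_zero 2 hy) ?_
  rw [derivUDerivation, Derivation.smul_apply, smul_eq_mul]
  set y := (1 - PowerSeries.C z * PowerSeries.X : PowerSeries ℂ) with hydef
  set w := poleSeries z
  set d := PowerSeries.derivative ℂ w
  have hz : PowerSeries.C z * PowerSeries.X = 1 - y := by rw [hydef]; ring
  linear_combination (-PowerSeries.X ^ 2 * y) * hd - PowerSeries.X ^ 2 * PowerSeries.C z * h
    + (w * y + PowerSeries.X) * h - PowerSeries.X ^ 2 * hz

variable {n : ℕ}

/-- The product of the functions `(u - z_i)^{-α_i}`. -/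
def poleMonomial (z : Fin n → ℂ) (α : Fin n → ℕ) : PowerSeries ℂ :=
  ∏ i, poleSeries (z i) ^ α i

theorem poleMonomial_mul (z : Fin n → ℂ) (α β : Fin n → ℕ) :
    poleMonomial z α * poleMonomial z β = poleMonomial z (α + β) := by
  simp only [poleMonomial, ← Finset.prod_mul_distrib, Pi.add_apply, pow_add]

theorem poleMonomial_single (z : Fin n → ℂ) (i : Fin n) :
    poleMonomial z (Pi.single i 1) = poleSeries (z i) := by
  rw [poleMonomial, Finset.prod_eq_single i] <;> simp +contextual

theorem derivUDerivation_poleSeries_pow (z : ℂ) (a : ℕ) :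
    derivUDerivation (poleSeries z ^ a) = poleSeries z ^ a * (-(a : ℂ) • poleSeries z) := by
  rw [Derivation.leibniz_pow, derivUDerivation_poleSeries]
  rcases a with _ | a
  · simp
  · simp only [Nat.add_sub_cancel, smul_eq_mul, nsmul_eq_mul, PowerSeries.smul_eq_C_mul]
    simp
    ring

/-- Logarithmic differentiation: each summand raises a single exponent by one, so the maximal pole
order grows by at most one. -/
theorem derivUDerivation_poleMonomial (z : Fin n → ℂ) (α : Fin n → ℕ) :
    derivUDerivation (poleMonomial z α)
      = ∑ i, (-(α i : ℂ)) • poleMonomial z (α + Pi.single i 1) := by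
  have key : ∀ s : Finset (Fin n), derivUDerivation (∏ i ∈ s, poleSeries (z i) ^ α i)
      = (∏ i ∈ s, poleSeries (z i) ^ α i) * ∑ i ∈ s, (-(α i : ℂ)) • poleSeries (z i) := by
    intro s
    induction s using Finset.induction_on with
    | empty => simp
    | insert i s hi ih =>
      rw [Finset.prod_insert hi, Finset.sum_insert hi, Derivation.leibniz, ih,
        derivUDerivation_poleSeries_pow]
      simp only [smul_eq_mul]
      ring
  rw [poleMonomial, key, Finset.mul_sum]
  refine Finset.sum_congr rfl fun i _ => ?_
  rw [← poleMonomial_mul, poleMonomial_single, mul_smul_comm]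
  rfl

/-- The space of scalar rational functions, expanded at infinity, that are bounded at infinity and
have poles of order at most `m` at the points `z_i` only. -/
def poleSpan (z : Fin n → ℂ) (m : ℕ) : Submodule ℂ (PowerSeries ℂ) :=
  Submodule.span ℂ (poleMonomial z '' {α | ∀ i, α i ≤ m})

theorem one_mem_poleSpan (z : Fin n → ℂ) (m : ℕ) : 1 ∈ poleSpan z m :=
  Submodule.subset_span ⟨0, fun _ => Nat.zero_le _, by simp [poleMonomial]⟩

theorem poleSeries_mem_poleSpan (z : Fin n → ℂ) (i : Fin n) : poleSeries (z i) ∈ poleSpan z 1 :=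
  Submodule.subset_span ⟨Pi.single i 1, fun j => by
    rcases eq_or_ne j i with rfl | h
    · simp
    · simp [h], poleMonomial_single z i⟩

theorem mul_mem_poleSpan {z : Fin n → ℂ} {a b : ℕ} {f g : PowerSeries ℂ} (hf : f ∈ poleSpan z a)
    (hg : g ∈ poleSpan z b) : f * g ∈ poleSpan z (a + b) := by
  have h := Submodule.mul_mem_mul hf hg
  rw [poleSpan, poleSpan, Submodule.span_mul_span] at h
  refine Submodule.span_mono ?_ h
  rintro _ ⟨_, ⟨α, hα, rfl⟩, _, ⟨β, hβ, rfl⟩, rfl⟩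
  exact ⟨α + β, fun i => Nat.add_le_add (hα i) (hβ i), (poleMonomial_mul z α β).symm⟩

theorem derivU_mem_poleSpan {z : Fin n → ℂ} {m : ℕ} {f : PowerSeries ℂ} (hf : f ∈ poleSpan z m) :
    derivU f ∈ poleSpan z (m + 1) := by
  rw [← derivUDerivation_apply]
  induction hf using Submodule.span_induction with
  | mem f hf =>
    obtain ⟨α, hα, rfl⟩ := hf
    rw [derivUDerivation_poleMonomial]
    refine sum_mem fun i _ => Submodule.smul_mem _ _ (Submodule.subset_span ⟨_, fun j => ?_, rfl⟩)
    refine Nat.add_le_add (hα j) ?_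
    rcases eq_or_ne j i with rfl | h
    · simp
    · simp [h]
  | zero => rw [map_zero]; exact zero_mem _
  | add f g _ _ hf hg => rw [map_add]; exact add_mem hf hg
  | smul c f _ hf => rw [Derivation.map_smul]; exact Submodule.smul_mem _ c hf

theorem exists_isExpansionOfRational_of_mem_poleSpan {z : Fin n → ℂ} {m : ℕ} {f : PowerSeries ℂ}
    (hf : f ∈ poleSpan z m) : ∃ p : Polynomial ℂ,
      IsExpansionOfRational f p ((∏ i, (Polynomial.X - Polynomial.C (z i))) ^ m) := by
  induction hf using Submodule.span_induction with
  | mem f hf =>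
    obtain ⟨α, hα, rfl⟩ := hf
    -- The numerator is what remains of the common denominator after cancelling the actual poles;
    -- the bound on `α` makes the subtraction exact.
    refine ⟨∏ i, (Polynomial.X - Polynomial.C (z i)) ^ (m - α i), ?_⟩
    have hmap : ∀ p : Polynomial ℂ, p.map (algebraMap ℂ ℂ) = p := fun p => Polynomial.map_id
    let L : Polynomial ℂ →* LaurentSeries ℂ :=
      { toFun := laurentAtInfinity
        map_one' := laurentAtInfinity_one
        map_mul' := laurentAtInfinity_mul }
    have hz : ∀ i, L (Polynomial.X - Polynomial.C (z i))
        * HahnSeries.ofPowerSeries ℤ ℂ (poleSeries (z i)) = 1 := by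
      intro i
      have := isExpansionOfRational_poleSeries (z i)
      rw [IsExpansionOfRational, hmap, laurentAtInfinity_one] at this
      exact this
    rw [IsExpansionOfRational, hmap]
    change L _ * _ = L _
    rw [poleMonomial, map_pow, map_prod, map_prod, map_prod, ← Finset.prod_pow,
      ← Finset.prod_mul_distrib]
    refine Finset.prod_congr rfl fun i _ => ?_
    have hm : m = (m - α i) + α i := (Nat.sub_add_cancel (hα i)).symm
    rw [map_pow, map_pow]
    conv_lhs => rw [hm]
    rw [pow_add, mul_assoc, ← mul_pow, hz, one_pow, mul_one]
  | zero => exact ⟨0, isExpansionOfRational_zero _⟩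
  | add f g _ _ hf hg =>
    obtain ⟨p, hp⟩ := hf
    obtain ⟨q, hq⟩ := hg
    exact ⟨p + q, hp.add hq⟩
  | smul c f _ hf =>
    obtain ⟨p, hp⟩ := hf
    have := hp.C_mul_map c
    rw [Algebra.algebraMap_self, PowerSeries.map_id, ← PowerSeries.smul_eq_C_mul] at this
    exact ⟨_, this⟩

end Poles

/-! ### Poles of the transfer matrices -/

section PoleFiltration

variable {A : Type*} [Ring A]

theorem map_derivU {B : Type*} [Ring B] (φ : A →+* B) (f : PowerSeries A) :
    PowerSeries.map φ (derivU f) = derivU (PowerSeries.map φ f) := by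
  ext s
  rcases s with _ | s <;> simp [derivU]

theorem derivU_add (f g : PowerSeries A) : derivU (f + g) = derivU f + derivU g := by
  ext s
  rcases s with _ | s
  · simp [derivU]
  · simp [derivU, mul_add]
    abel

theorem derivU_neg (f : PowerSeries A) : derivU (-f) = -derivU f := by
  ext s
  rcases s with _ | s <;> simp [derivU]

theorem derivU_zero : derivU (0 : PowerSeries A) = 0 := by
  ext s
  rcases s with _ | s <;> simp [derivU]

/-- If the entries of `X` have order at most one with respect to a multiplicative filtration in
which the derivative raises the order by one, the coefficient at `∂_u^j` of a product of `t`
operators `∂_u - X^{(i)}` has order at most `t - j`. -/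
theorem operatorProduct_mem_filtration {N : ℕ} (F : ℕ → AddSubgroup (PowerSeries A))
    (hone : 1 ∈ F 0) (hmul : ∀ {a b f g}, f ∈ F a → g ∈ F b → f * g ∈ F (a + b))
    (hderiv : ∀ {a f}, f ∈ F a → derivU f ∈ F (a + 1))
    {X : Matrix (Fin N) (Fin N) (PowerSeries A)} (hX : ∀ a b, X a b ∈ F 1) :
    ∀ (l : List (Fin N)) (j : ℕ),
      (j ≤ l.length → ∀ p q, operatorProduct X l j p q ∈ F (l.length - j)) ∧
      (l.length < j → operatorProduct X l j = 0)
  | [], j => by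
    refine ⟨fun hj p q => ?_, fun hj => ?_⟩
    · obtain rfl : j = 0 := by simpa using hj
      change (1 : Matrix (Fin N → Fin N) (Fin N → Fin N) (PowerSeries A)) p q ∈ F 0
      rcases eq_or_ne p q with rfl | h
      · rwa [Matrix.one_apply_eq]
      · rw [Matrix.one_apply_ne h]
        exact zero_mem _
    · exact if_neg (by simpa using hj.ne')
  | i :: l, j => by
    have ih := operatorProduct_mem_filtration F hone hmul hderiv hX l
    have hder0 : (0 : Matrix (Fin N → Fin N) (Fin N → Fin N) (PowerSeries A)).map derivU = 0 := by
      ext1 p q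
      exact derivU_zero
    change (_ → ∀ p q, (_ + (operatorProduct X l j).map derivU
      - inFactor X i * operatorProduct X l j) p q ∈ _) ∧
      (_ → _ + (operatorProduct X l j).map derivU - inFactor X i * operatorProduct X l j = 0)
    rw [List.length_cons]
    refine ⟨fun hj p q => ?_, fun hj => ?_⟩
    · rw [Matrix.sub_apply, Matrix.add_apply]
      have h1 : ((operatorProduct X l j).map derivU) p q ∈ F (l.length + 1 - j) ∧
          (inFactor X i * operatorProduct X l j) p q ∈ F (l.length + 1 - j) := by
        -- For `j = l.length + 1` only the shifted coefficient survives. The bound by truncated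
        -- subtraction would be too weak for the other two terms, which vanish.
        rcases Nat.lt_or_ge l.length j with h | h
        · rw [(ih j).2 h, hder0, Matrix.mul_zero]
          exact ⟨zero_mem _, zero_mem _⟩
        · refine ⟨?_, ?_⟩
          · rw [Nat.succ_sub h]
            exact hderiv ((ih j).1 h p q)
          · rw [Matrix.mul_apply, show l.length + 1 - j = 1 + (l.length - j) by omega]
            refine sum_mem fun r _ => hmul ?_ ((ih j).1 h r q)
            unfold inFactor
            split_ifs
            · exact hX _ _
            · exact zero_mem _
      refine sub_mem (add_mem ?_ h1.1) h1.2
      rcases j with _ | r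
      · exact zero_mem _
      · rw [Nat.add_sub_add_right]
        exact (ih r).1 (by omega) p q
    · rw [(ih j).2 (by omega), hder0, Matrix.mul_zero, sub_zero, add_zero]
      rcases j with _ | r
      · rfl
      · exact (ih r).2 (by omega)

variable [Algebra ℂ A] {n : ℕ}

/-- The space of `A`-valued rational functions, expanded at infinity, that are bounded at infinity
and have poles of order at most `m` at the points `z_i` only. -/
def poleFiltration (A : Type*) [Ring A] [Algebra ℂ A] (z : Fin n → ℂ) (m : ℕ) :
    AddSubgroup (PowerSeries A) :=
  AddSubgroup.closure {G | ∃ a : A, ∃ f ∈ poleSpan z m,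
    G = PowerSeries.C a * PowerSeries.map (algebraMap ℂ A) f}

theorem C_mul_map_mem_poleFiltration {z : Fin n → ℂ} {m : ℕ} (a : A) {f : PowerSeries ℂ}
    (hf : f ∈ poleSpan z m) :
    PowerSeries.C a * PowerSeries.map (algebraMap ℂ A) f ∈ poleFiltration A z m :=
  AddSubgroup.subset_closure ⟨a, f, hf, rfl⟩

theorem C_mem_poleFiltration (z : Fin n → ℂ) (m : ℕ) (a : A) :
    PowerSeries.C a ∈ poleFiltration A z m := by
  simpa using C_mul_map_mem_poleFiltration a (one_mem_poleSpan z m)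

theorem map_algebraMap_commute_C (f : PowerSeries ℂ) (a : A) :
    PowerSeries.map (algebraMap ℂ A) f * PowerSeries.C a
      = PowerSeries.C a * PowerSeries.map (algebraMap ℂ A) f := by
  ext s
  rw [PowerSeries.coeff_mul_C, PowerSeries.coeff_C_mul, PowerSeries.coeff_map, Algebra.commutes]

theorem mul_mem_poleFiltration {z : Fin n → ℂ} {a b : ℕ} {f g : PowerSeries A}
    (hf : f ∈ poleFiltration A z a) (hg : g ∈ poleFiltration A z b) :
    f * g ∈ poleFiltration A z (a + b) := by
  induction hf using AddSubgroup.closure_induction with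
  | mem f hf =>
    obtain ⟨x, f, hf, rfl⟩ := hf
    induction hg using AddSubgroup.closure_induction with
    | mem g hg =>
      obtain ⟨y, g, hg, rfl⟩ := hg
      have : PowerSeries.C x * PowerSeries.map (algebraMap ℂ A) f
          * (PowerSeries.C y * PowerSeries.map (algebraMap ℂ A) g)
          = PowerSeries.C (x * y) * PowerSeries.map (algebraMap ℂ A) (f * g) := by
        rw [map_mul, map_mul, mul_assoc, ← mul_assoc (PowerSeries.map _ f),
          map_algebraMap_commute_C, mul_assoc, mul_assoc]
      rw [this]
      exact C_mul_map_mem_poleFiltration _ (mul_mem_poleSpan hf hg)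
    | zero => rw [mul_zero]; exact zero_mem _
    | add _ _ _ _ h1 h2 => rw [mul_add]; exact add_mem h1 h2
    | neg _ _ h => rw [mul_neg]; exact neg_mem h
  | zero => rw [zero_mul]; exact zero_mem _
  | add _ _ _ _ h1 h2 => rw [add_mul]; exact add_mem h1 h2
  | neg _ _ h => rw [neg_mul]; exact neg_mem h

theorem derivU_mem_poleFiltration {z : Fin n → ℂ} {m : ℕ} {f : PowerSeries A}
    (hf : f ∈ poleFiltration A z m) : derivU f ∈ poleFiltration A z (m + 1) := by
  induction hf using AddSubgroup.closure_induction with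
  | mem f hf =>
    obtain ⟨x, f, hf, rfl⟩ := hf
    have : derivU (PowerSeries.C x * PowerSeries.map (algebraMap ℂ A) f)
        = PowerSeries.C x * PowerSeries.map (algebraMap ℂ A) (derivU f) := by
      rw [map_derivU]
      ext s
      rcases s with _ | s
      · simp [derivU]
      · simp only [derivU, PowerSeries.coeff_mk, PowerSeries.coeff_C_mul, mul_neg, ← mul_assoc]
        rw [(Nat.cast_commute s x).eq]
    rw [this]
    exact C_mul_map_mem_poleFiltration _ (derivU_mem_poleSpan hf)
  | zero => rw [derivU_zero]; exact zero_mem _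
  | add _ _ _ _ h1 h2 => rw [derivU_add]; exact add_mem h1 h2
  | neg _ _ h => rw [derivU_neg]; exact neg_mem h

theorem exists_isExpansionOfRational_of_mem_poleFiltration {z : Fin n → ℂ} {m : ℕ}
    {G : PowerSeries A} (hG : G ∈ poleFiltration A z m) : ∃ P : Polynomial A,
      IsExpansionOfRational G P ((∏ i, (Polynomial.X - Polynomial.C (z i))) ^ m) := by
  induction hG using AddSubgroup.closure_induction with
  | mem f hf =>
    obtain ⟨x, f, hf, rfl⟩ := hf
    obtain ⟨p, hp⟩ := exists_isExpansionOfRational_of_mem_poleSpan hf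
    exact ⟨_, hp.C_mul_map x⟩
  | zero => exact ⟨0, isExpansionOfRational_zero _⟩
  | add _ _ _ _ h1 h2 =>
    obtain ⟨P, hP⟩ := h1
    obtain ⟨Q, hQ⟩ := h2
    exact ⟨P + Q, hP.add hQ⟩
  | neg _ _ h =>
    obtain ⟨P, hP⟩ := h
    exact ⟨-P, hP.neg⟩

end PoleFiltration

/-! ### Pole orders of the transfer matrices on tensor products -/

section TransferOperators

variable {N n : ℕ} {M : Fin n → Type*} [∀ i, AddCommGroup (M i)] [∀ i, Module ℂ (M i)]
  [∀ i, LieRingModule (LieGl N ℂ) (M i)] [∀ i, LieModule ℂ (LieGl N ℂ) (M i)]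

/-- Summing the geometric series at each site, `L_ab(u)` acts as the sum over `i` of `e_ba` at site
`i` divided by `u - z_i`. -/
theorem map_shiftedCurrent_mem_poleFiltration (z : Fin n → ℂ) (K : Matrix (Fin N) (Fin N) ℂ)
    (a b : Fin N) :
    PowerSeries.map (UniversalEnvelopingAlgebra.lift ℂ (evalTensorAction (N := N) M z)).toRingHom
      (shiftedCurrent K a b) ∈ poleFiltration (Module.End ℂ (⨂[ℂ] j, M j)) z 1 := by
  set Φ := UniversalEnvelopingAlgebra.lift ℂ (evalTensorAction (N := N) M z)
  have h : PowerSeries.map Φ.toRingHom (shiftedCurrent K a b)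
      = PowerSeries.C (algebraMap ℂ _ (K a b)) + ∑ i, PowerSeries.C (atSite i
          (LieModule.toEnd ℂ (LieGl N ℂ) (M i) (Matrix.single b a 1)))
        * PowerSeries.map (algebraMap ℂ _) (poleSeries (z i)) := by
    ext1 s
    rw [PowerSeries.coeff_map, map_add, map_sum]
    change Φ (coeffMatrix s (shiftedCurrent K) a b) = _
    rcases s with _ | s
    · rw [coeffMatrix_shiftedCurrent_zero, AlgHom.commutes]
      simp [poleSeries]
    · rw [coeffMatrix_shiftedCurrent_succ]
      simp only [PowerSeries.coeff_C_mul, PowerSeries.coeff_map]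
      rw [PowerSeries.coeff_C, if_neg (Nat.succ_ne_zero s), zero_add,
        UniversalEnvelopingAlgebra.lift_ι_apply]
      change ∑ i, atSite i (LieModule.toEnd ℂ (LieGl N ℂ) (M i) ((Matrix.single b a
        ((Polynomial.X : Polynomial ℂ) ^ s)).map (Polynomial.evalRingHom (z i)))) = _
      refine Finset.sum_congr rfl fun i _ => ?_
      have hx : ((Matrix.single b a ((Polynomial.X : Polynomial ℂ) ^ s)).map
          (Polynomial.evalRingHom (z i)) : LieGl N ℂ) = z i ^ s • Matrix.single b a 1 := by
        ext c d
        simp only [Matrix.map_apply, Matrix.single_apply, Matrix.smul_apply]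
        split_ifs <;> simp
      have hz : PowerSeries.coeff (s + 1) (poleSeries (z i)) = z i ^ s := by
        simp [poleSeries]
      rw [hx, hz, map_smul, map_smul, ← Algebra.commutes, ← Algebra.smul_def]
  rw [h]
  exact add_mem (C_mem_poleFiltration _ _ _) (sum_mem fun i _ =>
    C_mul_map_mem_poleFiltration _ (poleSeries_mem_poleSpan z i))

theorem gaudinTransferOn_mem_poleFiltration (z : Fin n → ℂ) (K : Matrix (Fin N) (Fin N) ℂ)
    {k : ℕ} (hk : k ≤ N) :
    gaudinTransferOn M z K k ∈ poleFiltration (Module.End ℂ (⨂[ℂ] j, M j)) z k := by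
  set Φ := (UniversalEnvelopingAlgebra.lift ℂ (evalTensorAction (N := N) M z)).toRingHom with hΦ
  have key : PowerSeries.map Φ (gaudinOperator K (N - k))
      ∈ poleFiltration (Module.End ℂ (⨂[ℂ] j, M j)) z k := by
    have hF := (operatorProduct_mem_filtration
      -- The filtration is pulled back to series over the enveloping algebra, where the operator
      -- product is defined; the action is a ring map commuting with the derivative.
      (F := fun m => (poleFiltration (Module.End ℂ (⨂[ℂ] j, M j)) z m).comap
        (PowerSeries.map Φ).toAddMonoidHom)
      (by
        change PowerSeries.map Φ 1 ∈ poleFiltration _ z 0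
        rw [map_one]
        simpa using C_mem_poleFiltration z 0 (1 : Module.End ℂ (⨂[ℂ] j, M j)))
      (fun {a b f g} hf hg => by
        change PowerSeries.map Φ (f * g) ∈ poleFiltration _ z (a + b)
        rw [map_mul]
        exact mul_mem_poleFiltration hf hg)
      (fun {a f} hf => by
        change PowerSeries.map Φ (derivU f) ∈ poleFiltration _ z (a + 1)
        rw [map_derivU]
        exact derivU_mem_poleFiltration hf)
      (map_shiftedCurrent_mem_poleFiltration z K) (List.finRange N) (N - k)).1 (by simp)
    rw [List.length_finRange, Nat.sub_sub_self hk] at hF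
    rw [gaudinOperator, Matrix.trace, map_sum]
    refine sum_mem fun p _ => ?_
    rw [Matrix.diag_apply, Matrix.mul_apply, map_sum]
    refine sum_mem fun q _ => ?_
    rw [map_mul]
    refine mul_mem_poleFiltration (b := 0) (hF p q) ?_
    rw [skewProjector, PowerSeries.algebraMap_apply, PowerSeries.map_C]
    exact C_mem_poleFiltration _ _ _
  rw [gaudinTransferOn, gaudinTransfer, map_mul, map_pow, map_neg, map_one, ← hΦ]
  rcases neg_one_pow_eq_or (PowerSeries (Module.End ℂ (⨂[ℂ] j, M j))) k with h | h
  · rwa [h, one_mul]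
  · rw [h, neg_one_mul]
    exact neg_mem key

/-! ### Symmetry of the transfer matrices -/

theorem tensorForm_atSite (S : ∀ i, LinearMap.BilinForm ℂ (M i)) (i : Fin n)
    {f g : Module.End ℂ (M i)} (h : ∀ x y, S i (f x) y = S i x (g y)) (w₁ w₂ : ⨂[ℂ] j, M j) :
    tensorForm S (atSite i f w₁) w₂ = tensorForm S w₁ (atSite i g w₂) := by
  induction w₁ using PiTensorProduct.induction_on with
  | smul_tprod r x =>
    induction w₂ using PiTensorProduct.induction_on with
    | smul_tprod r' y =>
      simp only [map_smul, LinearMap.smul_apply, atSite_apply, PiTensorProduct.map_tprod,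
        tensorForm_tprod]
      congr 2
      refine Finset.prod_congr rfl fun j _ => ?_
      rcases eq_or_ne j i with rfl | hj
      · simpa using h _ _
      · simp [Function.update_of_ne hj]
    | add y z hy hz => rw [map_add, map_add, map_add, hy, hz]
  | add y z hy hz => rw [map_add, map_add, map_add, LinearMap.add_apply, LinearMap.add_apply, hy, hz]

theorem tensorForm_evalTensorAction {S : ∀ i, LinearMap.BilinForm ℂ (M i)}
    (hS : ∀ i (x : LieGl N ℂ) w₁ w₂, S i ⁅x, w₁⁆ w₂ = S i w₁ ⁅x.transpose, w₂⁆) (z : Fin n → ℂ)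
    (x : LieGl N (Polynomial ℂ)) (w₁ w₂ : ⨂[ℂ] j, M j) :
    tensorForm S (evalTensorAction M z x w₁) w₂
      = tensorForm S w₁ (evalTensorAction M z x.transpose w₂) := by
  change tensorForm S ((∑ i, atSite i _) w₁) w₂ = tensorForm S w₁ ((∑ i, atSite i _) w₂)
  rw [LinearMap.sum_apply, LinearMap.sum_apply, map_sum, map_sum, LinearMap.sum_apply]
  refine Finset.sum_congr rfl fun i _ => tensorForm_atSite S i (fun x' y' => ?_) w₁ w₂
  exact hS i _ x' y'

/-- The operators that are symmetric with respect to a bilinear form. -/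
def symmetricOperators {W : Type*} [AddCommGroup W] [Module ℂ W] (B : LinearMap.BilinForm ℂ W) :
    Submodule ℂ (Module.End ℂ W) where
  carrier := {f | ∀ w₁ w₂, B (f w₁) w₂ = B w₁ (f w₂)}
  zero_mem' := fun w₁ w₂ => by simp
  add_mem' := fun {f g} hf hg w₁ w₂ => by simp [hf w₁ w₂, hg w₁ w₂]
  smul_mem' := fun c f hf w₁ w₂ => by simp [hf w₁ w₂]

/-- Contravariance moves a coefficient across the form as its image under `tau`, and for symmetric
`K` that image is the same coefficient. -/
theorem coeff_gaudinTransferOn_mem_symmetricOperators {S : ∀ i, LinearMap.BilinForm ℂ (M i)}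
    (hS : ∀ i (x : LieGl N ℂ) w₁ w₂, S i ⁅x, w₁⁆ w₂ = S i w₁ ⁅x.transpose, w₂⁆) (z : Fin n → ℂ)
    {K : Matrix (Fin N) (Fin N) ℂ} (hK : K.transpose = K) (k s : ℕ) :
    PowerSeries.coeff s (gaudinTransferOn M z K k) ∈ symmetricOperators (tensorForm S) := by
  intro w₁ w₂
  have := contravariant_of_lie (evalTensorAction M z) (tensorForm S)
    (tensorForm_evalTensorAction hS z) (PowerSeries.coeff s (gaudinTransfer K k)) w₁ w₂
  rw [tau_coeff_gaudinTransfer, hK] at this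
  rw [gaudinTransferOn, PowerSeries.coeff_map]
  exact this

end TransferOperators

end

theorem theorem9p1 (N : ℕ) (hN : 0 < N) (n : ℕ) (M : Fin n → Type*)
    [∀ i, AddCommGroup (M i)] [∀ i, Module ℂ (M i)]
    [∀ i, LieRingModule (LieGl N ℂ) (M i)] [∀ i, LieModule ℂ (LieGl N ℂ) (M i)]
    (Λ : Fin n → Fin N → ℂ) (v : ∀ i, M i) (hv : ∀ i, IsHighestWeight (Λ i) (v i)) :
    -- the series identity `τ(G_{k,K}(u)) = G_{k,Kᵀ}(u)` for an arbitrary matrix `K`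
    (∀ (K : Matrix (Fin N) (Fin N) ℂ) (k : ℕ), 1 ≤ k → k ≤ N → ∀ s : ℕ,
      tau N (Polynomial ℂ) (PowerSeries.coeff s (gaudinTransfer K k)) =
        PowerSeries.coeff s (gaudinTransfer K.transpose k)) ∧
    -- the Shapovalov forms exist and are unique
    (∀ i, ∃! S : LinearMap.BilinForm ℂ (M i), IsShapovalovForm (N := N) (v i) S) ∧
    -- for symmetric `K` the transfer matrices are symmetric, as series in `u⁻¹` and as rational
    -- functions of `u`, with respect to the tensor product of the Shapovalov forms
    ∀ S : ∀ i, LinearMap.BilinForm ℂ (M i), (∀ i, IsShapovalovForm (N := N) (v i) (S i)) →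
      ∀ (z : Fin n → ℂ) (K : Matrix (Fin N) (Fin N) ℂ), K.transpose = K →
      ∀ k : ℕ, 1 ≤ k → k ≤ N →
        (∀ (s : ℕ) (w₁ w₂ : ⨂[ℂ] i, M i),
          tensorForm S (PowerSeries.coeff s (gaudinTransferOn M z K k) w₁) w₂ =
            tensorForm S w₁ (PowerSeries.coeff s (gaudinTransferOn M z K k) w₂)) ∧
        ∃ P : Polynomial (Module.End ℂ (⨂[ℂ] i, M i)),
          IsExpansionOfRational (gaudinTransferOn M z K k) P
            ((∏ i, (Polynomial.X - Polynomial.C (z i))) ^ k) ∧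
          ∀ u : ℂ, (∀ i, u ≠ z i) → ∀ w₁ w₂ : ⨂[ℂ] i, M i,
            tensorForm S ((((∏ i, (u - z i)) ^ k)⁻¹ • P.eval (algebraMap ℂ _ u)) w₁) w₂ =
              tensorForm S w₁ ((((∏ i, (u - z i)) ^ k)⁻¹ • P.eval (algebraMap ℂ _ u)) w₂) := by
  refine ⟨fun K k _ _ s => tau_coeff_gaudinTransfer K k s, fun i => ?_, ?_⟩
  · obtain ⟨S, hS⟩ := (hv i).exists_shapovalovForm
    exact ⟨S, hS, fun T hT => (hv i).shapovalovForm_unique hT hS⟩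
  · intro S hS z K hK k _ hk
    have hsym := fun s => coeff_gaudinTransferOn_mem_symmetricOperators
      (fun i => (hS i).lie) z hK k s
    obtain ⟨P, hP⟩ := exists_isExpansionOfRational_of_mem_poleFiltration
      (gaudinTransferOn_mem_poleFiltration (M := M) z K hk)
    refine ⟨hsym, P, hP, fun u _ => ?_⟩
    refine (symmetricOperators (tensorForm S)).smul_mem _ ?_
    rw [Polynomial.eval_eq_sum, Polynomial.sum_def]
    refine sum_mem fun j _ => ?_
    -- Powers of `u` act as scalars, so the value of `P` is a complex combination of its
    -- coefficients, which are symmetric because those of the expansion are.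
    rw [← map_pow, ← Algebra.commutes, ← Algebra.smul_def]
    exact Submodule.smul_mem _ _ (hP.coeff_mem hsym j)
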